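/- Let $\underline k\le\bar k$ and $\underline u<\bar u$ be real numbers. Let $k\in(\mathrm{BV}\cap\mathrm L^\infty)(\mathbb R)$ with $k(x)\in[\underline k,\bar k]$ for a.e. $x$, and let $u_0\in(\mathrm L^\infty\cap\mathrm{BV})(\mathbb R)$ with $u_0(x)\in[\underline u,\bar u]$ for a.e. $x$, where $\mathrm{BV}(\mathbb R)$ means finite (essential) total variation. Put $C_{u_0}:=\max\{|\underline u|,|\bar u|\}$. Let $f=f(k,u)$ be a real function on $[\underline k,\bar k]\times[\underline u,\bar u]$ such that: for each $k$, $f(k,\cdot)\in C^3[\underline u,\bar u]$ is strictly convex, and there are constants $\gamma_1,\gamma_2$ with $0<\gamma_1\le f_{uu}(k,u)\le\gamma_2$ for all $(k,u)$; for each $u$, $f(\cdot,u)\in C^2[\underline k,\bar k]$ with $\partial^2_{kk}f\equiv0$, and $f_u(\cdot,u)\in C^1[\underline k,\bar k]$; and $f(k_1,\bar u)=f(k_2,\bar u)$, $f(k_1,\underline u)=f(k_2,\underline u)$ for all $k_1,k_2\in[\underline k,\bar k]$. Fix $\lambda>0$. For $\Delta x>0$ put $\Delta t=\lambda\Delta x$,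 $x_j=j\Delta x$ for $j\in\frac12\mathbb Z$, $k_j=\frac1{\Delta x}\int_{x_{j-1/2}}^{x_{j+1/2}}k(x)\,dx$ for $j\in\frac12\mathbb Z$, and $u_j^0=\frac1{\Delta x}\int_{x_{j-1/2}}^{x_{j+1/2}}u_0(x)\,dx$ for $j\in\mathbb Z$. For $n\ge0$ and $j+\frac n2\in\mathbb Z$ define $$\sigma_j^n=\operatorname{minmod}\bigl(u_{j+1}^n-u_j^n,\ \tfrac12(u_{j+1}^n-u_{j-1}^n),\ u_j^n-u_{j-1}^n\bigr),\qquad u_j^{n+1/2}=u_j^n-\tfrac\lambda2 f_u(k_j,u_j^n)\,\sigma_j^n,$$ $$u_{j+1/2}^{n+1}=\tfrac12(u_j^n+u_{j+1}^n)-\tfrac18(\sigma_{j+1}^n-\sigma_j^n)-\lambda\bigl(f(k_{j+1},u_{j+1}^{n+1/2})-f(k_j,u_j^{n+1/2})\bigr),$$ where $\operatorname{minmod}(a_1,a_2,a_3)=\operatorname{sgn}(a_1)\min_i|a_i|$ if $a_1,a_2,a_3$ all have the same sign, and $0$ otherwise. Assume that, for some real $\kappa$, the CFL condition $$\lambda\|f_u\|_\infty\le\kappa\le\min\Bigl\{\frac{\gamma_1}{7500\,\gamma_2},\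 \frac1{4000},\ \frac7{85+16C_{u_0}},\ \frac{\gamma_1}{\gamma_2\chi}\Bigr\},\qquad \chi:=228+13C_{u_0}+174\,C_{u_0}\gamma_2+12\,C_{u_0}^2\gamma_2,$$ holds, where $\|f_u\|_\infty$ is the supremum of $|f_u|$ over $[\underline k,\bar k]\times[\underline u,\bar u]$. Let $T,X>0$, and put $N:=\lfloor T/\Delta t\rfloor+1$ and $J:=\lfloor X/\Delta x\rfloor+1$. Then for every $\Delta x_0>0$ there is a constant $C(X,T)$, independent of $\Delta x$, such that for all $0<\Delta x\le\Delta x_0$ $$\Delta x\sum_{n=0}^{N-1}\ \sum_{\substack{|j|\le J\\ j+\frac n2\in\mathbb Z}}\bigl|u_{j+1}^n-u_j^n\bigr|^3\le C(X,T).$$ -/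

import Mathlib

open MeasureTheory

noncomputable section

namespace CentralScheme

/-- `g ∈ (L^∞ ∩ BV)(ℝ)`: `g` is measurable, essentially bounded, and its essential total variation
is finite, i.e. some function in its almost-everywhere class has finite total variation on `ℝ`. -/
def MemLinftyBV (g : ℝ → ℝ) : Prop :=
  MemLp g ⊤ volume ∧ ∃ v : ℝ → ℝ, g =ᵐ[volume] v ∧ BoundedVariationOn v Set.univ

/-- `f_u(k, u)`, the derivative with respect to the state `u ∈ [ulo, uhi]`
(one-sided at the end points). -/
def fluxDu (f : ℝ → ℝ → ℝ) (ulo uhi k u : ℝ) : ℝ :=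
  derivWithin (f k) (Set.Icc ulo uhi) u

/-- `f_{uu}(k, u)`, the second derivative with respect to the state `u ∈ [ulo, uhi]`. -/
def fluxDuu (f : ℝ → ℝ → ℝ) (ulo uhi k u : ℝ) : ℝ :=
  iteratedDerivWithin 2 (f k) (Set.Icc ulo uhi) u

/-- The assumptions on the flux `f : (k, u) ↦ f k u` on `[klo, khi] × [ulo, uhi]`. The values of `f`
outside this rectangle are irrelevant. -/
structure FluxHypotheses (f : ℝ → ℝ → ℝ) (klo khi ulo uhi γ₁ γ₂ : ℝ) : Prop where
  contDiffOn_u : ∀ k ∈ Set.Icc klo khi, ContDiffOn ℝ 3 (f k) (Set.Icc ulo uhi)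
  strictConvexOn_u : ∀ k ∈ Set.Icc klo khi, StrictConvexOn ℝ (Set.Icc ulo uhi) (f k)
  gamma_pos : 0 < γ₁
  fuu_ge : ∀ k ∈ Set.Icc klo khi, ∀ u ∈ Set.Icc ulo uhi, γ₁ ≤ fluxDuu f ulo uhi k u
  fuu_le : ∀ k ∈ Set.Icc klo khi, ∀ u ∈ Set.Icc ulo uhi, fluxDuu f ulo uhi k u ≤ γ₂
  contDiffOn_k : ∀ u ∈ Set.Icc ulo uhi, ContDiffOn ℝ 2 (fun k => f k u) (Set.Icc klo khi)
  fkk_eq_zero : ∀ u ∈ Set.Icc ulo uhi, ∀ k ∈ Set.Icc klo khi,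
    iteratedDerivWithin 2 (fun k => f k u) (Set.Icc klo khi) k = 0
  contDiffOn_fu_k : ∀ u ∈ Set.Icc ulo uhi,
    ContDiffOn ℝ 1 (fun k => fluxDu f ulo uhi k u) (Set.Icc klo khi)
  eq_at_top : ∀ k₁ ∈ Set.Icc klo khi, ∀ k₂ ∈ Set.Icc klo khi, f k₁ uhi = f k₂ uhi
  eq_at_bot : ∀ k₁ ∈ Set.Icc klo khi, ∀ k₂ ∈ Set.Icc klo khi, f k₁ ulo = f k₂ ulo

/-- The minmod function of three arguments. -/
def minmod (a b c : ℝ) : ℝ :=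
  if Real.sign a = Real.sign b ∧ Real.sign b = Real.sign c then
    Real.sign a * min |a| (min |b| |c|)
  else 0

/-! Grid functions are indexed by half-integer positions: the index `m : ℤ` stands for the point
`x_{m/2} = (m/2) Δx`. Neighbouring cells of one time level have indices `m` and `m + 2`, and the
staggered cell between them has index `m + 1`. -/

/-- Average of `g` over the cell of length `Δx` centred at `x_{m/2}`. -/
def cellAverage (g : ℝ → ℝ) (Δx : ℝ) (m : ℤ) : ℝ :=
  (1 / Δx) * ∫ x in (((m : ℝ) - 1) / 2 * Δx)..(((m : ℝ) + 1) / 2 * Δx), g x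

/-- The limited slope `σ` in the cell `m`. -/
def slope (v : ℤ → ℝ) (m : ℤ) : ℝ :=
  minmod (v (m + 2) - v m) ((1 / 2) * (v (m + 2) - v (m - 2))) (v m - v (m - 2))

/-- The mid-time value `u - (λ/2) f_u(k, u) σ` in the cell `m`; here `lam = Δt / Δx`. -/
def midValue (f : ℝ → ℝ → ℝ) (ulo uhi lam : ℝ) (κd v : ℤ → ℝ) (m : ℤ) : ℝ :=
  v m - lam / 2 * fluxDu f ulo uhi (κd m) (v m) * slope v m

/-- One time step of the staggered second-order scheme: the new value in the cell `m` from the old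
values in the cells `m - 1` and `m + 1` (and their slopes). -/
def step (f : ℝ → ℝ → ℝ) (ulo uhi lam : ℝ) (κd v : ℤ → ℝ) (m : ℤ) : ℝ :=
  (1 / 2) * (v (m - 1) + v (m + 1)) - (1 / 8) * (slope v (m + 1) - slope v (m - 1))
    - lam * (f (κd (m + 1)) (midValue f ulo uhi lam κd v (m + 1))
        - f (κd (m - 1)) (midValue f ulo uhi lam κd v (m - 1)))

/-- The approximate solution: `approx … n m` is `u^n_{m/2}`. At time level `n` the cells of the
scheme are those with `m + n` even; a step to such a cell only uses such cells of level `n - 1`, and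
the other values never enter. -/
def approx (f : ℝ → ℝ → ℝ) (ulo uhi lam : ℝ) (k u₀ : ℝ → ℝ) (Δx : ℝ) : ℕ → ℤ → ℝ
  | 0 => cellAverage u₀ Δx
  | n + 1 => step f ulo uhi lam (cellAverage k Δx) (approx f ulo uhi lam k u₀ Δx n)

/-- `C_{u₀} = max(|ulo|, |uhi|)`. -/
def boundC (ulo uhi : ℝ) : ℝ := max |ulo| |uhi|

/-- The constant `χ` of the CFL condition, with `c = C_{u₀}`. -/
def chi (c γ₂ : ℝ) : ℝ := 228 + 13 * c + 174 * c * γ₂ + 12 * c ^ 2 * γ₂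

/-- The CFL condition
`λ ‖f_u‖ ≤ κ ≤ min {γ₁/(7500 γ₂), 1/4000, 7/(85 + 16 C_{u₀}), γ₁/(γ₂ χ)}`,
with the supremum norm over `[klo, khi] × [ulo, uhi]` written out pointwise. -/
def CFL (f : ℝ → ℝ → ℝ) (klo khi ulo uhi γ₁ γ₂ lam κ : ℝ) : Prop :=
  (∀ k ∈ Set.Icc klo khi, ∀ u ∈ Set.Icc ulo uhi, lam * |fluxDu f ulo uhi k u| ≤ κ) ∧
  κ ≤ min (min (γ₁ / (7500 * γ₂)) (1 / 4000))
        (min (7 / (85 + 16 * boundC ulo uhi)) (γ₁ / (γ₂ * chi (boundC ulo uhi) γ₂)))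

/-- `∑_{n=0}^{N-1} ∑_{|j| ≤ J, j + n/2 ∈ ℤ} |u^n_{j+1} - u^n_j|³`, with `j = m/2`. -/
def cubicSum (u : ℕ → ℤ → ℝ) (N J : ℕ) : ℝ :=
  ∑ n ∈ Finset.range N,
    ∑ m ∈ (Finset.Icc (-(2 * (J : ℤ))) (2 * (J : ℤ))).filter (fun m => Even (m + (n : ℤ))),
      |u n (m + 2) - u n m| ^ 3

end CentralScheme

end

/-! The theorem is an energy estimate: the square of the cell values plus the square of the positive
parts of the jumps is a Lyapunov functional that loses a fixed multiple of |jump|³ at every edge and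
step.

The square entropy alone does not suffice. For a convex flux, its production across a jump is the
error of the trapezoidal rule for f. A downward jump d dissipates at least γ₁|d|³/6, whereas an
upward jump may produce entropy, at most d²/2 times the difference of the characteristic speeds at
its ends. But upward jumps are spread by those diverging speeds, so the sum of their squares falls
by d² times the same difference (`sq_posPart_sub_new_le`). This is twice the possible gain, and
uniform convexity bounds the difference below by γ₁d. Adding the two balances gives cubic decay for
both signs (`lyapunov_le`).

The rest has to be absorbed. The limiter contributes to the square balance (`sq_newValue_le`) a
dissipation Z = d(2d - s₀ - s₁) on an edge with jump d and end slopes s₀, s₁. Z controls the change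
of slope along the edge and, because minmod selects the smaller of two jumps of equal sign, the
difference of the positive parts of adjacent jumps. The quadratic term of the squared flux
difference is cancelled by the midpoint-in-time correction, up to Z and cubic terms. The remaining
cubic errors carry a factor κλγ₂, which the bound κ ≤ γ₁/(7500γ₂) makes small against λγ₁.

A varying coefficient is frozen at its left-cell value on each edge; the errors are multiples of
|k_{j+1} - k_j| (`exists_staggeredStep`), summable per time level by bounded variation. The
inequality is then summed over a finite window: each step costs a bounded amount for boundary fluxes
and coefficient variation, there are O(1/Δx) steps, and the initial functional on the window is
O(1/Δx). Multiplying by Δx gives the claim. -/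

namespace CentralScheme

/-! ### Square entropy balance on a single edge. -/

/-- `s` lies between `0` and `d`. -/
def BetweenZero (s d : ℝ) : Prop := (0 ≤ s ∧ s ≤ d) ∨ (d ≤ s ∧ s ≤ 0)

theorem BetweenZero.abs_le_abs {s d : ℝ} (h : BetweenZero s d) : |s| ≤ |d| := by
  rcases h with ⟨h1, h2⟩ | ⟨h1, h2⟩
  · rw [abs_of_nonneg h1, abs_of_nonneg (h1.trans h2)]; exact h2
  · rw [abs_of_nonpos h2, abs_of_nonpos (h1.trans h2)]; linarith

theorem BetweenZero.mul_sub_nonneg {s d : ℝ} (h : BetweenZero s d) : 0 ≤ d * (d - s) := by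
  rcases h with ⟨h1, h2⟩ | ⟨h1, h2⟩
  · exact mul_nonneg (h1.trans h2) (by linarith)
  · exact mul_nonneg_of_nonpos_of_nonpos (h1.trans h2) (by linarith)

/-- Write t - s = (d - s) - (d - t); both differences have the sign of d. This is how limiter
dissipation pays for every term containing a change of slope. -/
theorem BetweenZero.abs_sub_mul_abs_le {s t d : ℝ} (hs : BetweenZero s d) (ht : BetweenZero t d) :
    |t - s| * |d| ≤ d * (2 * d - s - t) := by
  rw [← abs_mul]
  apply abs_le.2
  have h1 := hs.mul_sub_nonneg
  have h2 := ht.mul_sub_nonneg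
  constructor <;> nlinarith

theorem BetweenZero.abs_sub_le {s t d : ℝ} (hs : BetweenZero s d) (ht : BetweenZero t d) :
    |t - s| ≤ |d| := by
  rcases hs with ⟨h1, h2⟩ | ⟨h1, h2⟩ <;> rcases ht with ⟨h3, h4⟩ | ⟨h3, h4⟩
  · rw [abs_of_nonneg (h1.trans h2)]; exact abs_le.2 ⟨by linarith, by linarith⟩
  · rw [abs_of_nonneg (h1.trans h2)]; exact abs_le.2 ⟨by linarith, by linarith⟩
  · rw [abs_of_nonneg (h3.trans h4)]; exact abs_le.2 ⟨by linarith, by linarith⟩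
  · rw [abs_of_nonpos (h1.trans h2)]; exact abs_le.2 ⟨by linarith, by linarith⟩

/-- The second-order part `R - ν² s / 2` of the time-averaged flux in a cell. -/
noncomputable def fluxCorrection (R ν s : ℝ) : ℝ := R - ν ^ 2 * s / 2

section

variable {κ ℓ e d s₀ s₁ R₀ R₁ ν₀ ν₁ μ : ℝ}

theorem abs_fluxCorrection_le (hℓ : 0 ≤ ℓ) (hℓd : ℓ * |d| ≤ 1)
    (hs : BetweenZero s₀ d) (hR : |R₀| ≤ ℓ * κ ^ 2 * s₀ ^ 2 / 4) (hν : |ν₀| ≤ κ) :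
    |fluxCorrection R₀ ν₀ s₀| ≤ κ ^ 2 * |d| := by
  have h1 := hs.abs_le_abs
  have hν2 : ν₀ ^ 2 ≤ κ ^ 2 := sq_le_sq' (by linarith [abs_le.1 hν]) (abs_le.1 hν).2
  have h2 : s₀ ^ 2 ≤ |d| ^ 2 := by rw [← sq_abs s₀]; gcongr
  have h3 : |ν₀ ^ 2 * s₀ / 2| ≤ κ ^ 2 * |d| / 2 := by
    rw [abs_div, abs_mul, abs_of_nonneg (sq_nonneg ν₀), abs_two]; gcongr
  have h4 : |R₀| ≤ κ ^ 2 * |d| / 4 := by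
    calc |R₀| ≤ ℓ * κ ^ 2 * s₀ ^ 2 / 4 := hR
      _ ≤ ℓ * κ ^ 2 * |d| ^ 2 / 4 := by gcongr
      _ = (ℓ * |d|) * (κ ^ 2 * |d|) / 4 := by ring
      _ ≤ 1 * (κ ^ 2 * |d|) / 4 := by gcongr
      _ = κ ^ 2 * |d| / 4 := by ring
  have h5 : 0 ≤ κ ^ 2 * |d| := by positivity
  calc |fluxCorrection R₀ ν₀ s₀| ≤ |R₀| + |ν₀ ^ 2 * s₀ / 2| := abs_sub _ _
    _ ≤ _ := by linarith

theorem abs_fluxCorrection_sub_le_mul (hκ : 0 ≤ κ) (hκ' : κ ≤ 1 / 7500) (hℓ : 0 ≤ ℓ)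
    (hℓd : ℓ * |d| ≤ 1)
    (hs₀ : BetweenZero s₀ d) (hs₁ : BetweenZero s₁ d)
    (hR₀ : |R₀| ≤ ℓ * κ ^ 2 * s₀ ^ 2 / 4) (hR₁ : |R₁| ≤ ℓ * κ ^ 2 * s₁ ^ 2 / 4)
    (hν₀ : |ν₀| ≤ κ) (hν₁ : |ν₁| ≤ κ) :
    |fluxCorrection R₁ ν₁ s₁ - fluxCorrection R₀ ν₀ s₀| ≤ κ * |d| := by
  have h0 := abs_fluxCorrection_le hℓ hℓd hs₀ hR₀ hν₀
  have h1 := abs_fluxCorrection_le hℓ hℓd hs₁ hR₁ hν₁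
  have h2 := abs_sub (fluxCorrection R₁ ν₁ s₁) (fluxCorrection R₀ ν₀ s₀)
  have h3 : κ ^ 2 * |d| ≤ 1 / 7500 * (κ * |d|) := by
    rw [sq, mul_assoc]; gcongr
  have h4 : 0 ≤ κ * |d| := by positivity
  linarith

/-- Finer than the linear bound by κ|d|. After multiplication by |d| the three terms become limiter
dissipation, a cubic error and a coefficient error. -/
theorem abs_fluxCorrection_sub_le (hκ : 0 ≤ κ) (hκ' : κ ≤ 1 / 7500) (hℓ : 0 ≤ ℓ)
    (hs₀ : BetweenZero s₀ d) (hs₁ : BetweenZero s₁ d)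
    (hR₀ : |R₀| ≤ ℓ * κ ^ 2 * s₀ ^ 2 / 4) (hR₁ : |R₁| ≤ ℓ * κ ^ 2 * s₁ ^ 2 / 4)
    (hν₀ : |ν₀| ≤ κ) (hν₁ : |ν₁| ≤ κ) (hμν₀ : |μ - ν₀| ≤ ℓ * |d|)
    (hμν₁ : |μ - ν₁| ≤ ℓ * |d| + e) :
    |fluxCorrection R₁ ν₁ s₁ - fluxCorrection R₀ ν₀ s₀| ≤
      κ ^ 2 / 2 * |s₁ - s₀| + 3 * κ * ℓ * d ^ 2 + κ * e * |d| := by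
  have hb0 := hs₀.abs_le_abs
  have hb1 := hs₁.abs_le_abs
  have hν2 : ν₁ ^ 2 ≤ κ ^ 2 := sq_le_sq' (by linarith [abs_le.1 hν₁]) (abs_le.1 hν₁).2
  have h2 : s₀ ^ 2 ≤ d ^ 2 := sq_le_sq.2 hb0
  have h2' : s₁ ^ 2 ≤ d ^ 2 := sq_le_sq.2 hb1
  have hR0 : |R₀| ≤ ℓ * κ ^ 2 * d ^ 2 / 4 := hR₀.trans (by gcongr)
  have hR1 : |R₁| ≤ ℓ * κ ^ 2 * d ^ 2 / 4 := hR₁.trans (by gcongr)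
  have hdiff : |ν₁ - ν₀| ≤ 2 * ℓ * |d| + e := by
    calc |ν₁ - ν₀| = |(μ - ν₀) - (μ - ν₁)| := by congr 1; ring
      _ ≤ |μ - ν₀| + |μ - ν₁| := abs_sub _ _
      _ ≤ _ := by linarith
  have hsq : |ν₁ ^ 2 - ν₀ ^ 2| ≤ 2 * κ * (2 * ℓ * |d| + e) := by
    rw [show ν₁ ^ 2 - ν₀ ^ 2 = (ν₁ + ν₀) * (ν₁ - ν₀) by ring, abs_mul]
    have h5 : |ν₁ + ν₀| ≤ 2 * κ := (abs_add_le _ _).trans (by linarith)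
    gcongr
  have hterm1 : |ν₁ ^ 2 * (s₁ - s₀)| ≤ κ ^ 2 * |s₁ - s₀| := by
    rw [abs_mul, abs_of_nonneg (sq_nonneg ν₁)]; gcongr
  have hterm2 : |(ν₁ ^ 2 - ν₀ ^ 2) * s₀| ≤ 2 * κ * (2 * ℓ * |d| + e) * |d| := by
    rw [abs_mul]
    exact mul_le_mul hsq hb0 (abs_nonneg _) ((abs_nonneg _).trans hsq)
  have hdd : |d| * |d| = d ^ 2 := by rw [← sq, sq_abs]
  have hsmall : ℓ * κ ^ 2 * d ^ 2 ≤ κ * ℓ * d ^ 2 := by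
    have : ℓ * κ ^ 2 * d ^ 2 = κ * (κ * ℓ * d ^ 2) := by ring
    have h9 : 0 ≤ κ * ℓ * d ^ 2 := by positivity
    nlinarith
  have h10 : 0 ≤ κ * ℓ * d ^ 2 := by positivity
  have key : fluxCorrection R₁ ν₁ s₁ - fluxCorrection R₀ ν₀ s₀ =
      R₁ - R₀ - (ν₁ ^ 2 * (s₁ - s₀) + (ν₁ ^ 2 - ν₀ ^ 2) * s₀) / 2 := by
    unfold fluxCorrection; ring
  have e1 : 2 * κ * (2 * ℓ * |d| + e) * |d| = 4 * (κ * ℓ * d ^ 2) + 2 * (κ * e * |d|) := by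
    rw [← hdd]; ring
  rw [e1] at hterm2
  rw [key]
  obtain ⟨a1, a2⟩ := abs_le.1 hterm1
  obtain ⟨b1, b2⟩ := abs_le.1 hterm2
  obtain ⟨c1, c2⟩ := abs_le.1 hR0
  obtain ⟨d1, d2⟩ := abs_le.1 hR1
  apply abs_le.2
  constructor <;> linarith

/-- Entropy balance on one edge: the square of the new value is bounded by old squares, divided
differences, the signed cubic entropy production and the (dissipative) limiter term. -/
theorem sq_newValue_le {a b q₀ q₁ P : ℝ} (hd : d = b - a) (hκ : 0 ≤ κ) (hκ' : κ ≤ 1 / 7500)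
    (hℓ : 0 ≤ ℓ) (he : 0 ≤ e)
    (hℓd : ℓ * |d| ≤ 1) (hs₀ : BetweenZero s₀ d) (hs₁ : BetweenZero s₁ d)
    (hR₀ : |R₀| ≤ ℓ * κ ^ 2 * s₀ ^ 2 / 4) (hR₁ : |R₁| ≤ ℓ * κ ^ 2 * s₁ ^ 2 / 4)
    (hν₀ : |ν₀| ≤ κ) (hν₁ : |ν₁| ≤ κ) (hμ : |μ| ≤ κ) (hμν₀ : |μ - ν₀| ≤ ℓ * |d|)
    (hμν₁ : |μ - ν₁| ≤ ℓ * |d| + e)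
    (hprod : -((a + b) * (μ * d)) ≤ q₀ - q₁ + P + e) :
    ((a + b) / 2 - (s₁ - s₀) / 8
        - (μ * d + (fluxCorrection R₁ ν₁ s₁ - fluxCorrection R₀ ν₀ s₀))) ^ 2 ≤
      (a ^ 2 + b ^ 2) / 2 - (b * s₁ - a * s₀) / 4
        - 2 * (b * fluxCorrection R₁ ν₁ s₁ - a * fluxCorrection R₀ ν₀ s₀) + (q₀ - q₁) + P
        - (7 / 64 - κ) * (d * (2 * d - s₀ - s₁)) + 3 * κ * ℓ * |d| ^ 3 + e * (1 + d ^ 2) := by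
  have hg1 := abs_fluxCorrection_sub_le_mul hκ hκ' hℓ hℓd hs₀ hs₁ hR₀ hR₁ hν₀ hν₁
  have hg2 := abs_fluxCorrection_sub_le hκ hκ' hℓ hs₀ hs₁ hR₀ hR₁ hν₀ hν₁ hμν₀ hμν₁
  set r₀ := fluxCorrection R₀ ν₀ s₀ with hr₀
  set r₁ := fluxCorrection R₁ ν₁ s₁ with hr₁
  set g := r₁ - r₀ with hg
  set Z := d * (2 * d - s₀ - s₁) with hZ
  have hw := hs₀.abs_sub_mul_abs_le hs₁
  have hw' := hs₀.abs_sub_le hs₁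
  rw [← hZ] at hw
  have hZ0 : 0 ≤ Z := (by positivity : 0 ≤ |s₁ - s₀| * |d|).trans hw
  have hdd : |d| * |d| = d ^ 2 := by rw [← sq, sq_abs]
  have hd3 : d ^ 2 * |d| = |d| ^ 3 := by rw [← sq_abs d]; ring
  have hssq : (s₁ - s₀) ^ 2 ≤ Z := by
    rw [← sq_abs, sq]
    exact (mul_le_mul_of_nonneg_left hw' (abs_nonneg _)).trans hw
  have hμd : |μ * d| ≤ κ * |d| := by rw [abs_mul]; gcongr
  have hh : |μ * d + g| ≤ 2 * κ * |d| := (abs_add_le _ _).trans (by linarith)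
  have hcross : (s₁ - s₀) / 4 * (μ * d + g) ≤ κ / 2 * Z := by
    calc (s₁ - s₀) / 4 * (μ * d + g) ≤ |(s₁ - s₀) / 4 * (μ * d + g)| := le_abs_self _
      _ = |s₁ - s₀| / 4 * |μ * d + g| := by rw [abs_mul, abs_div]; norm_num
      _ ≤ |s₁ - s₀| / 4 * (2 * κ * |d|) := by gcongr
      _ = κ / 2 * (|s₁ - s₀| * |d|) := by ring
      _ ≤ κ / 2 * Z := by gcongr
  have hg3 : 2 * (μ * d) * g + g ^ 2 ≤ 3 * κ * |d| * |g| := by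
    have h1 : (μ * d) * g ≤ κ * |d| * |g| := by
      calc (μ * d) * g ≤ |(μ * d) * g| := le_abs_self _
        _ = |μ * d| * |g| := abs_mul _ _
        _ ≤ _ := by gcongr
    have h2 : g ^ 2 ≤ κ * |d| * |g| := by
      rw [← sq_abs, sq]; gcongr
    linarith
  have hg4 : 3 * κ * |d| * |g| ≤
      3 / 2 * κ ^ 3 * Z + 9 * κ ^ 2 * (ℓ * |d| ^ 3) + 3 * κ ^ 2 * (e * d ^ 2) := by
    calc 3 * κ * |d| * |g| ≤ 3 * κ * |d| *
          (κ ^ 2 / 2 * |s₁ - s₀| + 3 * κ * ℓ * d ^ 2 + κ * e * |d|) := by gcongr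
      _ = 3 / 2 * κ ^ 3 * (|s₁ - s₀| * |d|) + 9 * κ ^ 2 * (ℓ * (d ^ 2 * |d|))
          + 3 * κ ^ 2 * (e * (|d| * |d|)) := by ring
      _ ≤ _ := by rw [hd3, hdd]; gcongr
  -- The second-order cancellation: r₀ + r₁ contains -(ν₀² s₀ + ν₁² s₁)/2, which offsets μ² d² when
  -- the slopes equal d and the speeds agree. Slope defects go into Z, and speed defects are of
  -- order ℓ|d| + e.
  have hmain : μ ^ 2 * d ^ 2 + d * (r₀ + r₁) ≤
      κ * (2 * ℓ * |d| + e) * d ^ 2 + κ ^ 2 / 2 * Z + κ ^ 2 / 2 * (ℓ * |d| ^ 3) := by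
    have hA := hs₀.mul_sub_nonneg
    have hB := hs₁.mul_sub_nonneg
    have hn0 : ν₀ ^ 2 ≤ κ ^ 2 := sq_le_sq' (by linarith [abs_le.1 hν₀]) (abs_le.1 hν₀).2
    have hn1 : ν₁ ^ 2 ≤ κ ^ 2 := sq_le_sq' (by linarith [abs_le.1 hν₁]) (abs_le.1 hν₁).2
    have e0 : (μ - ν₀) * (μ + ν₀) ≤ 2 * κ * (ℓ * |d|) := by
      calc (μ - ν₀) * (μ + ν₀) ≤ |(μ - ν₀) * (μ + ν₀)| := le_abs_self _
        _ = |μ + ν₀| * |μ - ν₀| := by rw [abs_mul, mul_comm]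
        _ ≤ (2 * κ) * (ℓ * |d|) := by
          gcongr; exact (abs_add_le _ _).trans (by linarith)
    have e1 : (μ - ν₁) * (μ + ν₁) ≤ 2 * κ * (ℓ * |d| + e) := by
      calc (μ - ν₁) * (μ + ν₁) ≤ |(μ - ν₁) * (μ + ν₁)| := le_abs_self _
        _ = |μ + ν₁| * |μ - ν₁| := by rw [abs_mul, mul_comm]
        _ ≤ (2 * κ) * (ℓ * |d| + e) := by
          gcongr; exact (abs_add_le _ _).trans (by linarith)
    have hRb : ∀ R s : ℝ, |R| ≤ ℓ * κ ^ 2 * s ^ 2 / 4 → |s| ≤ |d| →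
        d * R ≤ κ ^ 2 / 4 * (ℓ * |d| ^ 3) := by
      intro R s hR hs
      have h2 : s ^ 2 ≤ d ^ 2 := sq_le_sq.2 hs
      calc d * R ≤ |d * R| := le_abs_self _
        _ = |d| * |R| := abs_mul _ _
        _ ≤ |d| * (ℓ * κ ^ 2 * d ^ 2 / 4) := by
          gcongr; exact hR.trans (by gcongr)
        _ = κ ^ 2 / 4 * (ℓ * (d ^ 2 * |d|)) := by ring
        _ = _ := by rw [hd3]
    have hR0 := hRb R₀ s₀ hR₀ hs₀.abs_le_abs
    have hR1 := hRb R₁ s₁ hR₁ hs₁.abs_le_abs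
    have e0' := mul_le_mul_of_nonneg_right e0 (sq_nonneg d)
    have e1' := mul_le_mul_of_nonneg_right e1 (sq_nonneg d)
    have hA' := mul_le_mul_of_nonneg_right hn0 hA
    have hB' := mul_le_mul_of_nonneg_right hn1 hB
    have : μ ^ 2 * d ^ 2 + d * (r₀ + r₁) = ((μ - ν₀) * (μ + ν₀) * d ^ 2
        + (μ - ν₁) * (μ + ν₁) * d ^ 2 + ν₀ ^ 2 * (d * (d - s₀)) + ν₁ ^ 2 * (d * (d - s₁))) / 2
        + (d * R₀ + d * R₁) := by
      simp only [hr₀, hr₁, fluxCorrection]; ring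
    rw [this]
    have : Z = d * (d - s₀) + d * (d - s₁) := by rw [hZ]; ring
    rw [this]
    linarith
  -- The loss -d²/4 from averaging combines with d(s₀ + s₁)/8 to -Z/8. Since (s₁ - s₀)²/64 ≤ Z/64,
  -- the coefficient 7/64 remains.
  have hid : ((a + b) / 2 - (s₁ - s₀) / 8 - (μ * d + g)) ^ 2 =
      (a ^ 2 + b ^ 2) / 2 - (b * s₁ - a * s₀) / 4 - 2 * (b * r₁ - a * r₀)
      + -((a + b) * (μ * d)) - Z / 8 + (s₁ - s₀) ^ 2 / 64 + (s₁ - s₀) / 4 * (μ * d + g)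
      + (μ ^ 2 * d ^ 2 + d * (r₀ + r₁)) + (2 * (μ * d) * g + g ^ 2) := by
    rw [hZ, hg, hd]; ring
  rw [hid]
  have hL : 0 ≤ ℓ * |d| ^ 3 := by positivity
  have hE : 0 ≤ e * d ^ 2 := by positivity
  have c1 : κ * (2 * ℓ * |d| + e) * d ^ 2 = 2 * κ * (ℓ * |d| ^ 3) + κ * (e * d ^ 2) := by
    rw [← hd3]; ring
  have k2 : κ ^ 2 ≤ κ / 7500 := by
    rw [sq]; exact (mul_le_mul_of_nonneg_left hκ' hκ).trans_eq (by ring)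
  have k3 : κ ^ 3 ≤ κ / 7500 := by
    calc κ ^ 3 = κ * κ ^ 2 := by ring
      _ ≤ 1 * κ ^ 2 := by gcongr; linarith
      _ ≤ κ / 7500 := by linarith
  have z1 : κ ^ 2 / 2 * Z + 3 / 2 * κ ^ 3 * Z ≤ κ / 2 * Z := by
    rw [← add_mul]; exact mul_le_mul_of_nonneg_right (by linarith) hZ0
  have z2 : 2 * κ * (ℓ * |d| ^ 3) + κ ^ 2 / 2 * (ℓ * |d| ^ 3) + 9 * κ ^ 2 * (ℓ * |d| ^ 3)
      ≤ 3 * κ * ℓ * |d| ^ 3 := by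
    rw [← add_mul, ← add_mul, mul_assoc (3 * κ)]
    exact mul_le_mul_of_nonneg_right (by linarith) hL
  have z3 : κ * (e * d ^ 2) + 3 * κ ^ 2 * (e * d ^ 2) ≤ e * d ^ 2 := by
    rw [← add_mul]; exact mul_le_of_le_one_left hE (by linarith)
  have z4 : (7 / 64 - κ) * Z = 7 / 64 * Z - κ * Z := by ring
  have z5 : κ / 2 * Z = κ * Z / 2 := by ring
  have z6 : e * (1 + d ^ 2) = e + e * d ^ 2 := by ring
  rw [z4, z6]
  rw [z5] at z1 hcross
  linarith

end

/-! ### Positive parts of the jumps. -/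

section

variable {κ ℓ e d s s₀ s₁ g μ : ℝ}

/-- A new jump is a sum of one half-contribution from each edge at the node. When d ≤ 0 the term d/2
outweighs the others, which are at most |d|/8 + 2κ|d|, so the contribution is nonpositive and can be
dropped. When d > 0 the slopes are their own positive parts. -/
theorem half_sub_le_posPart (hs₀ : BetweenZero s₀ d) (hs₁ : BetweenZero s₁ d) (hκ : κ ≤ 1 / 8)
    (hμ : |μ| ≤ κ) (hg : |g| ≤ κ * |d|) :
    d / 2 - ((s₁ - s₀) / 8 + μ * d + g) ≤
      max d 0 / 2 - ((max s₁ 0 - max s₀ 0) / 8 + μ * max d 0) + (if 0 < d then |g| else 0) := by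
  split_ifs with hd
  · rcases hs₀ with ⟨h1, h2⟩ | ⟨h1, h2⟩ <;> rcases hs₁ with ⟨h3, h4⟩ | ⟨h3, h4⟩ <;> try linarith
    rw [max_eq_left hd.le, max_eq_left h1, max_eq_left h3]
    linarith [neg_abs_le g]
  · have hd' := not_lt.1 hd
    have h0 : s₀ ≤ 0 ∧ d ≤ s₀ := by
      rcases hs₀ with ⟨h1, h2⟩ | ⟨h1, h2⟩ <;> constructor <;> linarith
    have h1 : s₁ ≤ 0 ∧ d ≤ s₁ := by
      rcases hs₁ with ⟨h1, h2⟩ | ⟨h1, h2⟩ <;> constructor <;> linarith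
    rw [max_eq_right hd', max_eq_right h0.1, max_eq_right h1.1]
    rw [abs_of_nonpos hd'] at hg
    have hm : -(μ * d) ≤ κ * (-d) := by
      have := mul_le_mul_of_nonneg_right ((abs_le.1 hμ).2) (neg_nonneg.2 hd'); linarith
    have hk : κ * (-d) ≤ 1 / 8 * (-d) := mul_le_mul_of_nonneg_right hκ (neg_nonneg.2 hd')
    linarith [neg_abs_le g]

theorem half_add_le_posPart (hs₀ : BetweenZero s₀ d) (hs₁ : BetweenZero s₁ d) (hκ : κ ≤ 1 / 8)
    (hμ : |μ| ≤ κ) (hg : |g| ≤ κ * |d|) :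
    d / 2 + ((s₁ - s₀) / 8 + μ * d + g) ≤
      max d 0 / 2 + ((max s₁ 0 - max s₀ 0) / 8 + μ * max d 0) + (if 0 < d then |g| else 0) := by
  have h := half_sub_le_posPart hs₁ hs₀ hκ (μ := -μ) (g := -g) (by rwa [abs_neg])
    (by rwa [abs_neg])
  rw [abs_neg] at h
  linarith

theorem abs_posPart_sub_mul_le (hs₀ : BetweenZero s₀ d) (hs₁ : BetweenZero s₁ d) :
    |max s₁ 0 - max s₀ 0| * max d 0 ≤ d * (2 * d - s₀ - s₁) ∧
      |max s₁ 0 - max s₀ 0| ≤ max d 0 := by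
  rcases le_total 0 d with hd | hd
  · have h0 : 0 ≤ s₀ := by rcases hs₀ with ⟨h1, h2⟩ | ⟨h1, h2⟩ <;> linarith
    have h1 : 0 ≤ s₁ := by rcases hs₁ with ⟨h1, h2⟩ | ⟨h1, h2⟩ <;> linarith
    rw [max_eq_left hd, max_eq_left h0, max_eq_left h1]
    have := hs₀.abs_sub_mul_abs_le hs₁
    have h3 := hs₀.abs_sub_le hs₁
    rw [abs_of_nonneg hd] at this h3
    exact ⟨this, h3⟩
  · rw [max_eq_right hd]
    have h0 : s₀ ≤ 0 := by rcases hs₀ with ⟨h1, h2⟩ | ⟨h1, h2⟩ <;> linarith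
    have h1 : s₁ ≤ 0 := by rcases hs₁ with ⟨h1, h2⟩ | ⟨h1, h2⟩ <;> linarith
    rw [max_eq_right h0, max_eq_right h1]
    have h3 := hs₀.mul_sub_nonneg
    have h4 := hs₁.mul_sub_nonneg
    constructor
    · simp only [sub_self, abs_zero, mul_zero]; linarith
    · simp

theorem posPart_mul_sub_le (hs : BetweenZero s d) :
    max d 0 * (max d 0 - max s 0) ≤ d * (d - s) := by
  rcases le_total 0 d with hd | hd
  · have h0 : 0 ≤ s := by rcases hs with ⟨h1, h2⟩ | ⟨h1, h2⟩ <;> linarith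
    rw [max_eq_left hd, max_eq_left h0]
  · rw [max_eq_right hd, zero_mul]
    exact hs.mul_sub_nonneg

/-- At a node whose limited slope has positive part the minimum of the positive parts of the two
adjacent jumps, the variation of these positive parts is controlled by the limiter dissipation. -/
theorem posPart_mul_abs_sub_le {d' t : ℝ} (hs₀ : BetweenZero s d) (hs₁ : BetweenZero s₁ d)
    (ht₀ : BetweenZero t d') (ht₁ : BetweenZero s d')
    (hmin : max s 0 = min (max d 0) (max d' 0)) :
    max d 0 * |max d 0 - max d' 0| ≤ d * (2 * d - s - s₁) + d' * (2 * d' - t - s) ∧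
    max d' 0 * |max d 0 - max d' 0| ≤ d * (2 * d - s - s₁) + d' * (2 * d' - t - s) := by
  have h1 := posPart_mul_sub_le hs₀
  have h2 := posPart_mul_sub_le ht₁
  have a1 := hs₀.mul_sub_nonneg
  have a2 := hs₁.mul_sub_nonneg
  have a3 := ht₀.mul_sub_nonneg
  have a4 := ht₁.mul_sub_nonneg
  have p0 : 0 ≤ max d 0 := le_max_right _ _
  have p1 : 0 ≤ max d' 0 := le_max_right _ _
  rcases le_total (max d 0) (max d' 0) with h | h
  · rw [min_eq_left h] at hmin
    rw [hmin] at h2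
    rw [abs_of_nonpos (by linarith)]
    have := mul_le_mul_of_nonneg_right h (sub_nonneg.2 h)
    constructor <;> linarith
  · rw [min_eq_right h] at hmin
    rw [hmin] at h1
    rw [abs_of_nonneg (by linarith)]
    have := mul_le_mul_of_nonneg_right h (sub_nonneg.2 h)
    constructor <;> linarith

end

/-- The square of the majorant of the new divided difference at a node, in terms of the positive
parts `p`, `p'` of the old jumps on the two adjacent edges. -/
theorem sq_jumpMajorant_le {κ ℓ e e' d d' p p' τ τ' Z Z' μ μ' ν ν' z z' : ℝ}
    (hκ : 0 ≤ κ) (hκ' : κ ≤ 1 / 7500) (hℓ : 0 ≤ ℓ) (he : 0 ≤ e) (he' : 0 ≤ e')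
    (hp : 0 ≤ p) (hp' : 0 ≤ p') (hpd : p ≤ |d|) (hpd' : p' ≤ |d'|)
    (hτ : |τ| ≤ p) (hτ' : |τ'| ≤ p') (hτZ : |τ| * p ≤ Z) (hτZ' : |τ'| * p' ≤ Z')
    (hN : p * |p - p'| ≤ Z + Z') (hN' : p' * |p - p'| ≤ Z + Z')
    (hμ : |μ| ≤ κ) (hμ' : |μ'| ≤ κ) (hν : |ν| ≤ κ)
    (hμν : |μ - ν| ≤ ℓ * |d|) (hμν' : |ν' - μ'| ≤ ℓ * |d'|) (hνν' : |ν - ν'| ≤ e')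
    (hz : 0 ≤ z) (hz' : 0 ≤ z') (hz1 : z ≤ κ * p) (hz1' : z' ≤ κ * p')
    (hz2 : z ≤ κ ^ 2 / 2 * |τ| + 3 * κ * ℓ * p ^ 2 + κ * e * p)
    (hz2' : z' ≤ κ ^ 2 / 2 * |τ'| + 3 * κ * ℓ * p' ^ 2 + κ * e' * p') :
    ((p + p') / 2 - (τ - τ') / 8 - (μ * p - μ' * p') + (z + z')) ^ 2 ≤
      (p ^ 2 + p' ^ 2) / 2 - (p * τ - p' * τ') / 4 - (μ * p ^ 2 - μ' * p' ^ 2)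
        + (1 / 32 + 7 * κ) * (Z + Z') - p ^ 2 * (μ - ν) - p' ^ 2 * (ν' - μ')
        + 34 * κ * ℓ * (|d| ^ 3 + |d'| ^ 3) + 2 * (e + e') * (p + p') ^ 2 := by
  have hZ : 0 ≤ Z := (by positivity : 0 ≤ |τ| * p).trans hτZ
  have hZ' : 0 ≤ Z' := (by positivity : 0 ≤ |τ'| * p').trans hτZ'
  set S := Z + Z' with hS
  have hτsq : τ ^ 2 ≤ Z := by
    rw [← sq_abs, sq]; exact (mul_le_mul_of_nonneg_left hτ (abs_nonneg _)).trans hτZ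
  have hτsq' : τ' ^ 2 ≤ Z' := by
    rw [← sq_abs, sq]; exact (mul_le_mul_of_nonneg_left hτ' (abs_nonneg _)).trans hτZ'
  have k2 : κ ^ 2 ≤ κ / 7500 := by
    rw [sq]; exact (mul_le_mul_of_nonneg_left hκ' hκ).trans_eq (by ring)
  have hS0 : 0 ≤ S := add_nonneg hZ hZ'
  have hκS : 0 ≤ κ * S := by positivity
  -- A slope variation on one edge meets the jump on the other; exchanging p' for p costs |p - p'|,
  -- which the node estimates `hN` and `hN'` control.
  have hcrossτ : (|τ| + |τ'|) * (p + p') ≤ 4 * S := by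
    have h1 : |τ| * p' ≤ Z + S := by
      have : p' ≤ p + |p - p'| := by linarith [neg_abs_le (p - p')]
      calc |τ| * p' ≤ |τ| * (p + |p - p'|) := by gcongr
        _ = |τ| * p + |τ| * |p - p'| := by ring
        _ ≤ |τ| * p + p * |p - p'| := by gcongr
        _ ≤ _ := by linarith
    have h2 : |τ'| * p ≤ Z' + S := by
      have : p ≤ p' + |p - p'| := by linarith [le_abs_self (p - p')]
      calc |τ'| * p ≤ |τ'| * (p' + |p - p'|) := by gcongr
        _ = |τ'| * p' + |τ'| * |p - p'| := by ring
        _ ≤ |τ'| * p' + p' * |p - p'| := by gcongr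
        _ ≤ _ := by linarith
    linarith
  have hπ : (p - p') ^ 2 ≤ 2 * S := by
    have h1 : |p - p'| ≤ p + p' := abs_le.2 ⟨by linarith, by linarith⟩
    calc (p - p') ^ 2 = |p - p'| * |p - p'| := by rw [← sq, sq_abs]
      _ ≤ (p + p') * |p - p'| := by gcongr
      _ ≤ _ := by linarith
  set η := μ * p - μ' * p' with hη
  set ζ := z + z' with hζ
  set x := (τ - τ') / 8 with hx
  have hsq : ((p + p') / 2 - x) ^ 2 ≤ (p ^ 2 + p' ^ 2) / 2 - (p * τ - p' * τ') / 4 + S / 32 := by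
    have := sq_nonneg ((p - p') / 2 - (τ + τ') / 8)
    simp only [hx, hS]
    linarith
  have hητ : 2 * x * η ≤ κ * S := by
    have h1 : |η| ≤ κ * (p + p') := by
      calc |η| ≤ |μ * p| + |μ' * p'| := abs_sub _ _
        _ = |μ| * p + |μ'| * p' := by
          rw [abs_mul, abs_mul, abs_of_nonneg hp, abs_of_nonneg hp']
        _ ≤ κ * p + κ * p' := by gcongr
        _ = _ := by ring
    have h2 : |2 * x| ≤ (|τ| + |τ'|) / 4 := by
      rw [show 2 * x = (τ - τ') / 4 by rw [hx]; ring, abs_div, abs_of_pos (by norm_num : (0:ℝ) < 4)]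
      gcongr; exact abs_sub _ _
    calc 2 * x * η ≤ |2 * x * η| := le_abs_self _
      _ = |2 * x| * |η| := abs_mul _ _
      _ ≤ (|τ| + |τ'|) / 4 * (κ * (p + p')) := by gcongr
      _ = κ / 4 * ((|τ| + |τ'|) * (p + p')) := by ring
      _ ≤ κ / 4 * (4 * S) := by gcongr
      _ = _ := by ring
  have hμν2 : |μ - ν| ≤ 2 * κ := (abs_sub _ _).trans (by linarith)
  have hμν2' : |ν - μ'| ≤ 2 * κ := (abs_sub _ _).trans (by linarith)
  -- Comparing both mid-edge speeds with those at the common node extracts the spreading: a flux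
  -- difference, minus one half-edge contribution from each side. What remains carries a factor p -
  -- p' or the mismatch ν - ν' caused by the coefficient.
  have hyη : -((p + p') * η) ≤ -(μ * p ^ 2 - μ' * p' ^ 2) - p ^ 2 * (μ - ν) - p' ^ 2 * (ν' - μ')
      + 4 * κ * S + p' ^ 2 * e' := by
    have h1 : p * (p - p') * (μ - ν) ≤ 2 * κ * S := by
      calc p * (p - p') * (μ - ν) ≤ |p * (p - p') * (μ - ν)| := le_abs_self _
        _ = (p * |p - p'|) * |μ - ν| := by rw [abs_mul, abs_mul, abs_of_nonneg hp]
        _ ≤ S * (2 * κ) := by gcongr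
        _ = _ := by ring
    have h2 : -(p' * (p - p') * (ν - μ')) ≤ 2 * κ * S := by
      calc -(p' * (p - p') * (ν - μ')) ≤ |p' * (p - p') * (ν - μ')| := neg_le_abs _
        _ = (p' * |p - p'|) * |ν - μ'| := by rw [abs_mul, abs_mul, abs_of_nonneg hp']
        _ ≤ S * (2 * κ) := by gcongr
        _ = _ := by ring
    have h3 : -(p' ^ 2 * (ν - ν')) ≤ p' ^ 2 * e' := by
      rw [← mul_neg]; gcongr; linarith [(abs_le.1 hνν').1]
    have : -((p + p') * η) = -(μ * p ^ 2 - μ' * p' ^ 2) - p ^ 2 * (μ - ν) - p' ^ 2 * (ν' - μ')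
      + p * (p - p') * (μ - ν) + -(p' * (p - p') * (ν - μ')) + -(p' ^ 2 * (ν - ν')) := by
      rw [hη]; ring
    linarith
  have hcub : ∀ a b : ℝ, 0 ≤ a → 0 ≤ b → a * b ^ 2 ≤ a ^ 3 + b ^ 3 := by
    intro a b ha hb
    rcases le_total a b with h | h
    · have : a * b ^ 2 ≤ b * b ^ 2 := by gcongr
      have h3 : 0 ≤ a ^ 3 := by positivity
      linarith [show b * b ^ 2 = b ^ 3 by ring]
    · have : a * b ^ 2 ≤ a * a ^ 2 := by gcongr
      have h3 : 0 ≤ b ^ 3 := by positivity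
      linarith [show a * a ^ 2 = a ^ 3 by ring]
  have hcub' : ∀ a b c : ℝ, 0 ≤ a → 0 ≤ b → b ≤ c → a * b ^ 2 ≤ a ^ 3 + c ^ 3 := fun a b c ha hb hc =>
    (mul_le_mul_of_nonneg_left (pow_le_pow_left₀ hb hc 2) ha).trans (hcub a c ha (hb.trans hc))
  set D := |d| ^ 3 + |d'| ^ 3 with hD
  have hp3 : p ^ 3 ≤ |d| ^ 3 := pow_le_pow_left₀ hp hpd 3
  have hp3' : p' ^ 3 ≤ |d'| ^ 3 := pow_le_pow_left₀ hp' hpd' 3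
  have hℓD : 0 ≤ κ * ℓ * D := by positivity
  have hζb : (p + p') * ζ ≤ 2 * κ ^ 2 * S + 6 * κ * ℓ * D + κ * (e + e') * (p + p') ^ 2 := by
    have h1 : (p + p') * (p ^ 2 + p' ^ 2) ≤ 2 * D := by
      have c1 : 0 ≤ (p + p') * (p - p') ^ 2 := by positivity
      have : (p + p') * (p ^ 2 + p' ^ 2) = 2 * (p ^ 3 + p' ^ 3) - (p + p') * (p - p') ^ 2 := by
        ring
      rw [this, hD]; linarith
    have h2 : (p + p') * (e * p + e' * p') ≤ (e + e') * (p + p') ^ 2 := by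
      have : e * p + e' * p' ≤ (e + e') * (p + p') := by
        have := mul_nonneg he hp'
        have := mul_nonneg he' hp
        linarith
      calc (p + p') * (e * p + e' * p') ≤ (p + p') * ((e + e') * (p + p')) := by gcongr
        _ = _ := by ring
    calc (p + p') * ζ ≤ (p + p') * ((κ ^ 2 / 2 * |τ| + 3 * κ * ℓ * p ^ 2 + κ * e * p) +
          (κ ^ 2 / 2 * |τ'| + 3 * κ * ℓ * p' ^ 2 + κ * e' * p')) := by
          gcongr; exact add_le_add hz2 hz2'
      _ = κ ^ 2 / 2 * ((|τ| + |τ'|) * (p + p')) + 3 * κ * ℓ * ((p + p') * (p ^ 2 + p' ^ 2))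
          + κ * ((p + p') * (e * p + e' * p')) := by ring
      _ ≤ κ ^ 2 / 2 * (4 * S) + 3 * κ * ℓ * (2 * D) + κ * ((e + e') * (p + p') ^ 2) := by gcongr
      _ = _ := by ring
  have hY : (p + p') / 2 - x ≤ p + p' := by
    have h1 := abs_le.1 hτ
    have h2 := abs_le.1 hτ'
    rw [hx]; linarith
  have hζ0 : 0 ≤ ζ := add_nonneg hz hz'
  have hYζ : 2 * ((p + p') / 2 - x) * ζ ≤ 2 * ((p + p') * ζ) := by
    have := mul_le_mul_of_nonneg_right hY hζ0; linarith
  have hζsq : 2 * ζ ^ 2 ≤ (p + p') * ζ := by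
    have h1 : ζ ≤ (p + p') / 2 := by
      have h2 : κ * p ≤ 1 / 2 * p := by gcongr; linarith
      have h3 : κ * p' ≤ 1 / 2 * p' := by gcongr; linarith
      linarith
    have := mul_le_mul_of_nonneg_right h1 hζ0
    linarith [sq ζ]
  -- Split η = μ(p - p') + (μ - μ')p'. In (μ - μ')² one factor is bounded by 2κ for smallness, the
  -- other by the jumps for cubic order.
  have hηsq : 2 * η ^ 2 ≤ 8 * κ ^ 2 * S + 16 * κ * ℓ * D + 8 * κ * (e' * p' ^ 2) := by
    have h1 : |μ - μ'| ≤ ℓ * |d| + ℓ * |d'| + e' := by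
      calc |μ - μ'| = |(μ - ν) + (ν - ν') + (ν' - μ')| := by congr 1; ring
        _ ≤ |μ - ν| + |ν - ν'| + |ν' - μ'| := abs_add_three _ _ _
        _ ≤ _ := by linarith
    have h2 : |μ - μ'| ≤ 2 * κ := (abs_sub _ _).trans (by linarith)
    have h3 : (μ - μ') ^ 2 ≤ 2 * κ * (ℓ * |d| + ℓ * |d'| + e') := by
      rw [← sq_abs, sq]; gcongr
    have h4 : |d| * p' ^ 2 ≤ D := hcub' _ _ _ (abs_nonneg _) hp' hpd'
    have h5 : |d'| * p' ^ 2 ≤ D := by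
      have : |d'| * p' ^ 2 ≤ |d'| * |d'| ^ 2 := by gcongr
      have h6 : 0 ≤ |d| ^ 3 := by positivity
      rw [hD]; linarith [show |d'| * |d'| ^ 2 = |d'| ^ 3 by ring]
    have h6 : (μ - μ') ^ 2 * p' ^ 2 ≤ 4 * κ * ℓ * D + 2 * κ * (e' * p' ^ 2) := by
      calc (μ - μ') ^ 2 * p' ^ 2 ≤ 2 * κ * (ℓ * |d| + ℓ * |d'| + e') * p' ^ 2 := by gcongr
        _ = 2 * κ * ℓ * (|d| * p' ^ 2) + 2 * κ * ℓ * (|d'| * p' ^ 2) + 2 * κ * (e' * p' ^ 2) := by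
          ring
        _ ≤ 2 * κ * ℓ * D + 2 * κ * ℓ * D + 2 * κ * (e' * p' ^ 2) := by gcongr
        _ = _ := by ring
    have h7 : μ ^ 2 ≤ κ ^ 2 := sq_le_sq' (by linarith [abs_le.1 hμ]) (abs_le.1 hμ).2
    have h8 : μ ^ 2 * (p - p') ^ 2 ≤ κ ^ 2 * (2 * S) := by gcongr
    have h9 : η = μ * (p - p') + (μ - μ') * p' := by rw [hη]; ring
    have h10 := sq_nonneg (μ * (p - p') - (μ - μ') * p')
    have h11 : 2 * η ^ 2 ≤ 4 * (μ ^ 2 * (p - p') ^ 2) + 4 * ((μ - μ') ^ 2 * p' ^ 2) := by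
      rw [h9]; linarith
    linarith
  have hηζ : (η - ζ) ^ 2 ≤ 2 * η ^ 2 + 2 * ζ ^ 2 := by linarith [sq_nonneg (η + ζ)]
  have hEE : p' ^ 2 * e' ≤ (e + e') * (p + p') ^ 2 := by
    calc p' ^ 2 * e' ≤ (p + p') ^ 2 * (e + e') := by gcongr <;> linarith
      _ = _ := by ring
  have hE0 : 0 ≤ (e + e') * (p + p') ^ 2 := by positivity
  have hid : ((p + p') / 2 - x - η + ζ) ^ 2 = ((p + p') / 2 - x) ^ 2 + -((p + p') * η)
      + 2 * x * η + 2 * ((p + p') / 2 - x) * ζ + (η - ζ) ^ 2 := by ring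
  rw [hid]
  have m1 : κ ^ 2 * S ≤ κ / 7500 * S := mul_le_mul_of_nonneg_right k2 hS0
  have m2 : κ * ((e + e') * (p + p') ^ 2) ≤ 1 / 7500 * ((e + e') * (p + p') ^ 2) :=
    mul_le_mul_of_nonneg_right hκ' hE0
  have m3 : κ * (e' * p' ^ 2) ≤ 1 / 7500 * ((e + e') * (p + p') ^ 2) :=
    mul_le_mul hκ' (by linarith) (by positivity) (by norm_num)
  have t1 : (1 / 32 + 7 * κ) * S = S / 32 + 7 * (κ * S) := by ring
  have t2 : 34 * κ * ℓ * D = 34 * (κ * ℓ * D) := by ring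
  have t3 : κ / 7500 * S = κ * S / 7500 := by ring
  rw [t1, t2]
  rw [t3] at m1
  linarith

/-! ### Abstract staggered steps and their Lyapunov inequality. -/

/-- Data of one time step of a staggered scheme with limited slopes `σ`: old values `u`, new values
`v` (with `v j` between `u j` and `u (j + 1)`), characteristic speeds `ν j`, `ν' j` at the two ends
and `μ j` in the middle of the `j`-th edge, an entropy flux `q`, and errors `e` coming from the
spatial dependence of the flux. -/
structure StaggeredStep (κ ℓ₁ ℓ₂ U B : ℝ) (u v σ R ν ν' μ q e ε : ℤ → ℝ) : Prop where
  κ_nonneg : 0 ≤ κ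
  κ_le : κ ≤ 1 / 7500
  κ_mul_le : κ * ℓ₂ ≤ ℓ₁ / 7500
  ℓ₂_nonneg : 0 ≤ ℓ₂
  ℓ₂_mul_le : ∀ j, ℓ₂ * |u (j + 1) - u j| ≤ 1
  abs_u_le : ∀ j, |u j| ≤ U
  abs_v_le : ∀ j, |v j| ≤ U
  slope_left : ∀ j, BetweenZero (σ (j + 1)) (u (j + 1) - u j)
  slope_right : ∀ j, BetweenZero (σ j) (u (j + 1) - u j)
  posPart_slope : ∀ j,
    max (σ (j + 1)) 0 = min (max (u (j + 1 + 1) - u (j + 1)) 0) (max (u (j + 1) - u j) 0)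
  abs_ν_le : ∀ j, |ν j| ≤ κ
  abs_ν'_le : ∀ j, |ν' j| ≤ κ
  abs_μ_le : ∀ j, |μ j| ≤ κ
  abs_R_le : ∀ j, |R j| ≤ ℓ₂ * κ ^ 2 * σ j ^ 2 / 4
  abs_μ_sub_ν_le : ∀ j, |μ j - ν j| ≤ ℓ₂ * |u (j + 1) - u j|
  abs_ν'_sub_μ_le : ∀ j, |ν' j - μ j| ≤ ℓ₂ * |u (j + 1) - u j|
  le_ν'_sub_ν : ∀ j, 0 ≤ u (j + 1) - u j → ℓ₁ * (u (j + 1) - u j) ≤ ν' j - ν j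
  e_nonneg : ∀ j, 0 ≤ e j
  abs_ν_sub_ν'_le : ∀ j, |ν (j + 1) - ν' j| ≤ e j
  abs_ε_le : ∀ j, |ε j| ≤ e j
  abs_q_le : ∀ j, |q j| ≤ B
  entropy_le : ∀ j, -((u j + u (j + 1)) * (μ j * (u (j + 1) - u j))) ≤
    q j - q (j + 1) + (max (u (j + 1) - u j) 0 ^ 2 * (ν' j - ν j) / 2
      - ℓ₁ / 6 * max (-(u (j + 1) - u j)) 0 ^ 3) + e j
  v_eq : ∀ j, v j = (u j + u (j + 1)) / 2 - (σ (j + 1) - σ j) / 8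
    - (μ j * (u (j + 1) - u j) + (fluxCorrection (R (j + 1)) (ν (j + 1)) (σ (j + 1))
      - fluxCorrection (R j) (ν j) (σ j))) - ε j

/-- The Lyapunov density: the square of the value and of the positive part of a jump. -/
def lyapunov (a d : ℝ) : ℝ := a ^ 2 + max d 0 ^ 2

theorem sq_le_sq_add_of_sub {x y δ M : ℝ} (hx : |x| ≤ M) (h : x = y - δ) :
    x ^ 2 ≤ y ^ 2 + 2 * M * |δ| := by
  have h1 : -(x * δ) ≤ M * |δ| := by
    calc -(x * δ) ≤ |x * δ| := neg_le_abs _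
      _ = |x| * |δ| := abs_mul _ _
      _ ≤ _ := by gcongr
  have : y = x + δ := by linarith
  rw [this]
  nlinarith [sq_nonneg δ]

/-- The a priori bound M keeps the error linear in δ, as required for coefficient errors that are
only summable. -/
theorem sq_posPart_le_of_le {x W M δ : ℝ} (hx : x ≤ M) (hM : 0 ≤ M) (hδ : 0 ≤ δ)
    (h : x ≤ W + δ) : max x 0 ^ 2 ≤ W ^ 2 + 2 * M * δ := by
  have h0 : 0 ≤ M * δ := mul_nonneg hM hδ
  rcases le_total x 0 with h1 | h1
  · rw [max_eq_right h1]; nlinarith [sq_nonneg W]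
  · rw [max_eq_left h1]
    have h2 : x * δ ≤ M * δ := by gcongr
    rcases le_total W 0 with h3 | h3
    · have : x * x ≤ x * δ := by gcongr; linarith
      nlinarith [sq_nonneg W]
    · rcases le_total x W with h4 | h4
      · have : x ^ 2 ≤ W ^ 2 := by gcongr
        linarith
      · have h5 : x * x ≤ x * (W + δ) := by gcongr
        have h6 : W * x ≤ W * (W + δ) := by gcongr
        have h7 : W * δ ≤ x * δ := by gcongr
        nlinarith

section

variable {κ ℓ₁ ℓ₂ U B : ℝ} {u v σ R ν ν' μ q e ε : ℤ → ℝ}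

/-- The dissipation caused by the slope limiter on the `j`-th edge. -/
def limiterDissipation (u σ : ℤ → ℝ) (j : ℤ) : ℝ :=
  (u (j + 1) - u j) * (2 * (u (j + 1) - u j) - σ j - σ (j + 1))

/-- The numerical flux of the square entropy. -/
noncomputable def entropyNumFlux (u σ R ν q : ℤ → ℝ) (j : ℤ) : ℝ :=
  -(u j ^ 2 / 2) + u j * σ j / 4 + 2 * (u j * fluxCorrection (R j) (ν j) (σ j)) + q j

/-- The numerical flux of the squared positive jumps on the `j`-th edge. -/
noncomputable def jumpNumFlux (κ ℓ₂ : ℝ) (u σ ν' μ : ℤ → ℝ) (j : ℤ) : ℝ :=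
  max (u (j + 1) - u j) 0 ^ 2 / 2
    + max (u (j + 1) - u j) 0 * (max (σ (j + 1)) 0 - max (σ j) 0) / 4
    + μ j * max (u (j + 1) - u j) 0 ^ 2 + (1 / 32 + 7 * κ) * limiterDissipation u σ j
    - max (u (j + 1) - u j) 0 ^ 2 * (ν' j - μ j) + 34 * κ * ℓ₂ * |u (j + 1) - u j| ^ 3

namespace StaggeredStep

theorem limiterDissipation_nonneg (h : StaggeredStep κ ℓ₁ ℓ₂ U B u v σ R ν ν' μ q e ε) (j : ℤ) :
    0 ≤ limiterDissipation u σ j := by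
  have := (h.slope_right j).mul_sub_nonneg
  have := (h.slope_left j).mul_sub_nonneg
  unfold limiterDissipation
  linarith

theorem abs_μ_sub_ν_succ_le (h : StaggeredStep κ ℓ₁ ℓ₂ U B u v σ R ν ν' μ q e ε) (j : ℤ) :
    |μ j - ν (j + 1)| ≤ ℓ₂ * |u (j + 1) - u j| + e j := by
  have h1 := h.abs_ν'_sub_μ_le j
  have h2 := h.abs_ν_sub_ν'_le j
  calc |μ j - ν (j + 1)| = |(ν' j - μ j) + (ν (j + 1) - ν' j)| := by rw [← abs_neg]; congr 1; ring
    _ ≤ _ := (abs_add_le _ _).trans (add_le_add h1 h2)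

theorem abs_sub_le (h : StaggeredStep κ ℓ₁ ℓ₂ U B u v σ R ν ν' μ q e ε) (j : ℤ) :
    |u (j + 1) - u j| ≤ 2 * U :=
  (abs_sub _ _).trans (by linarith [h.abs_u_le j, h.abs_u_le (j + 1)])

theorem sq_sub_le (h : StaggeredStep κ ℓ₁ ℓ₂ U B u v σ R ν ν' μ q e ε) (j : ℤ) :
    (u (j + 1) - u j) ^ 2 ≤ 4 * U ^ 2 := by
  rw [← sq_abs]
  calc |u (j + 1) - u j| ^ 2 ≤ (2 * U) ^ 2 := by gcongr; exact h.abs_sub_le j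
    _ = _ := by ring

theorem U_nonneg (h : StaggeredStep κ ℓ₁ ℓ₂ U B u v σ R ν ν' μ q e ε) : 0 ≤ U :=
  (abs_nonneg _).trans (h.abs_u_le 0)

theorem sq_new_le (h : StaggeredStep κ ℓ₁ ℓ₂ U B u v σ R ν ν' μ q e ε) (j : ℤ) :
    v j ^ 2 ≤ u j ^ 2 + (entropyNumFlux u σ R ν q j - entropyNumFlux u σ R ν q (j + 1))
      + (max (u (j + 1) - u j) 0 ^ 2 * (ν' j - ν j) / 2
        - ℓ₁ / 6 * max (-(u (j + 1) - u j)) 0 ^ 3)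
      - (7 / 64 - κ) * limiterDissipation u σ j + 3 * κ * ℓ₂ * |u (j + 1) - u j| ^ 3
      + (1 + 2 * U + 4 * U ^ 2) * e j := by
  have h1 := sq_newValue_le rfl h.κ_nonneg h.κ_le h.ℓ₂_nonneg (h.e_nonneg j) (h.ℓ₂_mul_le j)
    (h.slope_right j) (h.slope_left j) (h.abs_R_le j) (h.abs_R_le (j + 1)) (h.abs_ν_le j)
    (h.abs_ν_le (j + 1)) (h.abs_μ_le j) (h.abs_μ_sub_ν_le j) (h.abs_μ_sub_ν_succ_le j)
    (h.entropy_le j)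
  have h2 := sq_le_sq_add_of_sub (h.abs_v_le j) (h.v_eq j)
  have h3 : 2 * U * |ε j| ≤ 2 * U * e j := by
    have := h.U_nonneg
    gcongr; exact h.abs_ε_le j
  have h4 : e j * (u (j + 1) - u j) ^ 2 ≤ e j * (4 * U ^ 2) :=
    mul_le_mul_of_nonneg_left (h.sq_sub_le j) (h.e_nonneg j)
  simp only [entropyNumFlux, limiterDissipation]
  linarith

/-- Both half-edge bounds are added at the node j + 1. The numbers z and z' are the absolute
flux-correction differences on upward edges and 0 on the others, so all their bounds can be stated
with positive parts. -/
theorem sub_new_le (h : StaggeredStep κ ℓ₁ ℓ₂ U B u v σ R ν ν' μ q e ε) (j : ℤ) :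
    ∃ z z' : ℝ, 0 ≤ z ∧ 0 ≤ z' ∧ z ≤ κ * max (u (j + 1 + 1) - u (j + 1)) 0 ∧
      z' ≤ κ * max (u (j + 1) - u j) 0 ∧
      z ≤ κ ^ 2 / 2 * |max (σ (j + 1 + 1)) 0 - max (σ (j + 1)) 0|
        + 3 * κ * ℓ₂ * max (u (j + 1 + 1) - u (j + 1)) 0 ^ 2
        + κ * e (j + 1) * max (u (j + 1 + 1) - u (j + 1)) 0 ∧
      z' ≤ κ ^ 2 / 2 * |max (σ (j + 1)) 0 - max (σ j) 0|
        + 3 * κ * ℓ₂ * max (u (j + 1) - u j) 0 ^ 2 + κ * e j * max (u (j + 1) - u j) 0 ∧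
      v (j + 1) - v j ≤
        ((max (u (j + 1 + 1) - u (j + 1)) 0 + max (u (j + 1) - u j) 0) / 2
          - ((max (σ (j + 1 + 1)) 0 - max (σ (j + 1)) 0) - (max (σ (j + 1)) 0 - max (σ j) 0)) / 8
          - (μ (j + 1) * max (u (j + 1 + 1) - u (j + 1)) 0 - μ j * max (u (j + 1) - u j) 0)
          + (z + z')) + (e (j + 1) + e j) := by
  have hg : ∀ i, |fluxCorrection (R (i + 1)) (ν (i + 1)) (σ (i + 1))
      - fluxCorrection (R i) (ν i) (σ i)| ≤ κ * |u (i + 1) - u i| := fun i =>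
    abs_fluxCorrection_sub_le_mul h.κ_nonneg h.κ_le h.ℓ₂_nonneg (h.ℓ₂_mul_le i)
      (h.slope_right i) (h.slope_left i) (h.abs_R_le i) (h.abs_R_le (i + 1)) (h.abs_ν_le i)
      (h.abs_ν_le (i + 1))
  have hg2 := fun i => abs_fluxCorrection_sub_le h.κ_nonneg h.κ_le h.ℓ₂_nonneg
    (h.slope_right i) (h.slope_left i) (h.abs_R_le i) (h.abs_R_le (i + 1)) (h.abs_ν_le i)
    (h.abs_ν_le (i + 1)) (h.abs_μ_sub_ν_le i) (h.abs_μ_sub_ν_succ_le i)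
  set g : ℤ → ℝ := fun i => fluxCorrection (R (i + 1)) (ν (i + 1)) (σ (i + 1))
      - fluxCorrection (R i) (ν i) (σ i) with hgdef
  have hκ0 := h.κ_nonneg
  have hℓ0 := h.ℓ₂_nonneg
  have hz0 : ∀ i, 0 ≤ (if 0 < u (i + 1) - u i then |g i| else 0) := by
    intro i; split_ifs <;> positivity
  have hz1 : ∀ i, (if 0 < u (i + 1) - u i then |g i| else 0) ≤ κ * max (u (i + 1) - u i) 0 := by
    intro i
    split_ifs with hd
    · rw [max_eq_left hd.le]
      have := hg i
      rwa [abs_of_pos hd] at this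
    · positivity
  have hz2 : ∀ i, (if 0 < u (i + 1) - u i then |g i| else 0) ≤
      κ ^ 2 / 2 * |max (σ (i + 1)) 0 - max (σ i) 0|
        + 3 * κ * ℓ₂ * max (u (i + 1) - u i) 0 ^ 2 + κ * e i * max (u (i + 1) - u i) 0 := by
    intro i
    have he := h.e_nonneg i
    split_ifs with hd
    · have := hg2 i
      rw [abs_of_pos hd] at this
      have s0 : 0 ≤ σ i := by
        rcases h.slope_right i with ⟨a, b⟩ | ⟨a, b⟩ <;> linarith
      have s1 : 0 ≤ σ (i + 1) := by
        rcases h.slope_left i with ⟨a, b⟩ | ⟨a, b⟩ <;> linarith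
      rw [max_eq_left hd.le, max_eq_left s0, max_eq_left s1]
      exact this
    · positivity
  have hκ8 : κ ≤ 1 / 8 := by linarith [h.κ_le]
  refine ⟨_, _, hz0 (j + 1), hz0 j, hz1 (j + 1), hz1 j, hz2 (j + 1), hz2 j, ?_⟩
  have a1 := half_sub_le_posPart (h.slope_right (j + 1)) (h.slope_left (j + 1)) hκ8
    (h.abs_μ_le (j + 1)) (hg (j + 1))
  have a2 := half_add_le_posPart (h.slope_right j) (h.slope_left j) hκ8 (h.abs_μ_le j) (hg j)
  have b1 := abs_le.1 (h.abs_ε_le (j + 1))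
  have b2 := abs_le.1 (h.abs_ε_le j)
  have c1 := h.v_eq (j + 1)
  have c2 := h.v_eq j
  simp only [hgdef] at a1 a2 ⊢
  linarith

/-- The node estimate involves both adjacent edges. `jumpNumFlux` moves the terms of edge j to edge
j + 1; the two half-edge spreadings μ - ν and ν' - μ thereby join into the full ν' - ν. -/
theorem sq_posPart_sub_new_le (h : StaggeredStep κ ℓ₁ ℓ₂ U B u v σ R ν ν' μ q e ε) (j : ℤ) :
    max (v (j + 1) - v j) 0 ^ 2 ≤ max (u (j + 1 + 1) - u (j + 1)) 0 ^ 2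
      + (jumpNumFlux κ ℓ₂ u σ ν' μ j - jumpNumFlux κ ℓ₂ u σ ν' μ (j + 1))
      + (1 / 16 + 14 * κ) * limiterDissipation u σ (j + 1)
      - max (u (j + 1 + 1) - u (j + 1)) 0 ^ 2 * (ν' (j + 1) - ν (j + 1))
      + 68 * κ * ℓ₂ * |u (j + 1 + 1) - u (j + 1)| ^ 3
      + (4 * U + 32 * U ^ 2) * (e (j + 1) + e j) := by
  obtain ⟨z, z', hz, hz', hz1, hz1', hz2, hz2', hle⟩ := h.sub_new_le j
  have hU := h.U_nonneg
  have he := h.e_nonneg j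
  have he' := h.e_nonneg (j + 1)
  have hp : ∀ i, max (u (i + 1) - u i) 0 ≤ |u (i + 1) - u i| := fun i =>
    max_le (le_abs_self _) (abs_nonneg _)
  obtain ⟨t1, t2⟩ := abs_posPart_sub_mul_le (h.slope_right (j + 1)) (h.slope_left (j + 1))
  obtain ⟨t1', t2'⟩ := abs_posPart_sub_mul_le (h.slope_right j) (h.slope_left j)
  obtain ⟨n1, n2⟩ := posPart_mul_abs_sub_le (h.slope_right (j + 1)) (h.slope_left (j + 1))
    (h.slope_right j) (h.slope_left j) (h.posPart_slope j)
  have h1 := sq_jumpMajorant_le h.κ_nonneg h.κ_le h.ℓ₂_nonneg he' he (le_max_right _ _)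
    (le_max_right _ _) (hp (j + 1)) (hp j) t2 t2' t1 t1' n1 n2 (h.abs_μ_le (j + 1)) (h.abs_μ_le j)
    (h.abs_ν_le (j + 1)) (h.abs_μ_sub_ν_le (j + 1)) (h.abs_ν'_sub_μ_le j) (h.abs_ν_sub_ν'_le j)
    hz hz' hz1 hz1' hz2 hz2'
  have hvv : v (j + 1) - v j ≤ 2 * U := by
    have := abs_le.1 (h.abs_v_le (j + 1))
    have := abs_le.1 (h.abs_v_le j)
    linarith
  have h2 := sq_posPart_le_of_le hvv (by positivity) (add_nonneg he' he) hle
  have h3 : 2 * (e (j + 1) + e j) * (max (u (j + 1 + 1) - u (j + 1)) 0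
      + max (u (j + 1) - u j) 0) ^ 2 ≤ 32 * U ^ 2 * (e (j + 1) + e j) := by
    have h4 := (hp (j + 1)).trans (h.abs_sub_le (j + 1))
    have h5 := (hp j).trans (h.abs_sub_le j)
    calc _ ≤ 2 * (e (j + 1) + e j) * (2 * U + 2 * U) ^ 2 := by gcongr
      _ = _ := by ring
  simp only [jumpNumFlux, limiterDissipation]
  linarith

/-- The pointwise Lyapunov inequality with cubic dissipation. -/
theorem lyapunov_le (h : StaggeredStep κ ℓ₁ ℓ₂ U B u v σ R ν ν' μ q e ε) (j : ℤ) :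
    lyapunov (v (j + 1)) (v (j + 1) - v j) ≤ lyapunov (u (j + 1)) (u (j + 1 + 1) - u (j + 1))
      + ((entropyNumFlux u σ R ν q (j + 1) + jumpNumFlux κ ℓ₂ u σ ν' μ j)
        - (entropyNumFlux u σ R ν q (j + 1 + 1) + jumpNumFlux κ ℓ₂ u σ ν' μ (j + 1)))
      - ℓ₁ / 8 * |u (j + 1 + 1) - u (j + 1)| ^ 3
      + (1 + 6 * U + 36 * U ^ 2) * (e (j + 1) + e j) := by
  have h1 := h.sq_new_le (j + 1)
  have h2 := h.sq_posPart_sub_new_le j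
  have hZ := h.limiterDissipation_nonneg (j + 1)
  -- The square balance supplies 7/64 - κ of limiter dissipation and the jump balance spends 1/16 +
  -- 14κ; the surplus is 3/64 - 15κ.
  have hκ : 15 * κ * limiterDissipation u σ (j + 1) ≤ 3 / 64 * limiterDissipation u σ (j + 1) :=
    mul_le_mul_of_nonneg_right (by linarith [h.κ_le]) hZ
  have hU := h.U_nonneg
  have he := mul_nonneg (by positivity : 0 ≤ 1 + 2 * U + 4 * U ^ 2) (h.e_nonneg j)
  have hm := h.le_ν'_sub_ν (j + 1)
  have hcub : κ * ℓ₂ * |u (j + 1 + 1) - u (j + 1)| ^ 3 ≤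
      ℓ₁ / 7500 * |u (j + 1 + 1) - u (j + 1)| ^ 3 :=
    mul_le_mul_of_nonneg_right h.κ_mul_le (by positivity)
  have hℓ₁ : 0 ≤ ℓ₁ := by
    have := mul_nonneg h.κ_nonneg h.ℓ₂_nonneg
    linarith [h.κ_mul_le]
  set d := u (j + 1 + 1) - u (j + 1) with hd
  -- Cubic decay for both signs: upward jumps keep half of their spreading, downward jumps have the
  -- entropy production. The errors 3κℓ₂ + 68κℓ₂ then reduce ℓ₁/6 to no less than ℓ₁/8.
  have hsign : ℓ₁ / 6 * |d| ^ 3 ≤ max d 0 ^ 2 * (ν' (j + 1) - ν (j + 1)) / 2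
      + ℓ₁ / 6 * max (-d) 0 ^ 3 := by
    rcases le_total 0 d with h0 | h0
    · rw [max_eq_left h0, max_eq_right (by linarith), abs_of_nonneg h0]
      have := mul_le_mul_of_nonneg_left (hm h0) (sq_nonneg d)
      have h3 : 0 ≤ ℓ₁ * d ^ 3 := by positivity
      nlinarith
    · rw [max_eq_right h0, max_eq_left (by linarith), abs_of_nonpos h0]
      simp
  have h3 : 0 ≤ ℓ₁ * |d| ^ 3 := by positivity
  simp only [lyapunov]
  linarith

theorem abs_fluxes_le (h : StaggeredStep κ ℓ₁ ℓ₂ U B u v σ R ν ν' μ q e ε) (j : ℤ) :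
    |entropyNumFlux u σ R ν q (j + 1) + jumpNumFlux κ ℓ₂ u σ ν' μ j| ≤ 20 * U ^ 2 + B := by
  have hU := h.U_nonneg
  have hκ := h.κ_le
  have hκ0 := h.κ_nonneg
  have hℓ0 := h.ℓ₂_nonneg
  have hdj := h.abs_sub_le j
  have hσ1 : |σ (j + 1)| ≤ 2 * U := (h.slope_left j).abs_le_abs.trans hdj
  have hr : |fluxCorrection (R (j + 1)) (ν (j + 1)) (σ (j + 1))| ≤ U := by
    have h1 := abs_fluxCorrection_le h.ℓ₂_nonneg (h.ℓ₂_mul_le j) (h.slope_left j)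
      (h.abs_R_le (j + 1)) (h.abs_ν_le (j + 1))
    calc _ ≤ κ ^ 2 * |u (j + 1) - u j| := h1
      _ ≤ (1 / 7500) ^ 2 * (2 * U) := by gcongr
      _ ≤ U := by linarith
  have hq := h.abs_q_le (j + 1)
  have hu := h.abs_u_le (j + 1)
  have mulb : ∀ x y a b : ℝ, |x| ≤ a → |y| ≤ b → |x * y| ≤ a * b := fun x y a b hx hy => by
    rw [abs_mul]; exact mul_le_mul hx hy (abs_nonneg _) ((abs_nonneg _).trans hx)
  have b1 := mulb _ _ _ _ hu hu
  have b2 := mulb _ _ _ _ hu hσ1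
  have b3 := mulb _ _ _ _ hu hr
  have hp : |max (u (j + 1) - u j) 0| ≤ 2 * U := by
    rw [abs_of_nonneg (le_max_right _ _)]
    exact (max_le (le_abs_self _) (abs_nonneg _)).trans hdj
  have ht : |max (σ (j + 1)) 0 - max (σ j) 0| ≤ 2 * U :=
    (abs_posPart_sub_mul_le (h.slope_right j) (h.slope_left j)).2.trans ((le_abs_self _).trans hp)
  have b4 := mulb _ _ _ _ hp hp
  have b5 := mulb _ _ _ _ hp ht
  have hμ : |μ j| ≤ 1 / 7500 := (h.abs_μ_le j).trans hκ
  have hνμ : |ν' j - μ j| ≤ 2 / 7500 :=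
    (abs_sub _ _).trans (by linarith [h.abs_μ_le j, h.abs_ν'_le j])
  have b6 := mulb _ _ _ _ hμ b4
  have b7 := mulb _ _ _ _ b4 hνμ
  have hZ0 := h.limiterDissipation_nonneg j
  have hZ : limiterDissipation u σ j ≤ 12 * U ^ 2 + 4 * U ^ 2 := by
    have c1 := mulb _ _ _ _ hdj hdj
    have hσ0 : |σ j| ≤ 2 * U := (h.slope_right j).abs_le_abs.trans hdj
    have c2 := mulb _ _ _ _ hdj hσ0
    have c3 := mulb _ _ _ _ hdj hσ1
    simp only [limiterDissipation]
    linarith [(abs_le.1 c1).2, (abs_le.1 c2).1, (abs_le.1 c3).1]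
  have b8 : (1 / 32 + 7 * κ) * limiterDissipation u σ j ≤ 1 / 16 * (16 * U ^ 2) := by
    gcongr <;> linarith
  have b8' : 0 ≤ (1 / 32 + 7 * κ) * limiterDissipation u σ j := by positivity
  have b9 : 34 * κ * ℓ₂ * |u (j + 1) - u j| ^ 3 ≤ 34 * (1 / 7500) * 1 * (4 * U ^ 2) := by
    calc 34 * κ * ℓ₂ * |u (j + 1) - u j| ^ 3
        = 34 * κ * (ℓ₂ * |u (j + 1) - u j|) * (u (j + 1) - u j) ^ 2 := by
          rw [← sq_abs (u (j + 1) - u j)]; ring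
      _ ≤ _ := by
        have := h.ℓ₂_mul_le j
        have := h.sq_sub_le j
        gcongr
  have b9' : 0 ≤ 34 * κ * ℓ₂ * |u (j + 1) - u j| ^ 3 := by positivity
  rw [abs_le] at b1 b2 b3 b4 b5 b6 b7 hq
  simp only [entropyNumFlux, jumpNumFlux, sq (max (u (j + 1) - u j) 0), sq (u (j + 1))]
  apply abs_le.2
  have hUU := sq_nonneg U
  constructor <;> linarith

/-- The Lyapunov inequality summed over a window of `L` cells. -/
theorem sum_lyapunov_le (h : StaggeredStep κ ℓ₁ ℓ₂ U B u v σ R ν ν' μ q e ε) (a : ℤ) (L : ℕ) :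
    ∑ t ∈ Finset.range L, lyapunov (v (a + t)) (v (a + t + 1) - v (a + t))
      + ℓ₁ / 8 * ∑ t ∈ Finset.range L, |u (a + t + 1) - u (a + t)| ^ 3 ≤
    ∑ t ∈ Finset.range L, lyapunov (u (a + t)) (u (a + t + 1) - u (a + t))
      + (48 * U ^ 2 + 2 * B) + (1 + 6 * U + 36 * U ^ 2) *
        (∑ t ∈ Finset.range L, e (a + t) + ∑ t ∈ Finset.range L, e (a + t - 1)) := by
  -- The pointwise inequality pairs a new value with the jump on its left, the summed functional
  -- with the jump on its right. Including the squared jump in G lets this shift telescope with the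
  -- fluxes.
  obtain ⟨G, hG⟩ : ∃ G : ℕ → ℝ, ∀ s : ℕ, G s = max (v (a + s) - v (a + s - 1)) 0 ^ 2
      - (entropyNumFlux u σ R ν q (a + s) + jumpNumFlux κ ℓ₂ u σ ν' μ (a + s - 1)) :=
    ⟨_, fun _ => rfl⟩
  have hpt : ∀ t ∈ Finset.range L, lyapunov (v (a + t)) (v (a + t + 1) - v (a + t))
      + ℓ₁ / 8 * |u (a + t + 1) - u (a + t)| ^ 3 ≤
      lyapunov (u (a + t)) (u (a + t + 1) - u (a + t))
      + (1 + 6 * U + 36 * U ^ 2) * (e (a + t) + e (a + t - 1)) + (G (t + 1) - G t) := by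
    intro t _
    have := h.lyapunov_le (a + t - 1)
    simp only [sub_add_cancel] at this
    simp only [hG, Nat.cast_add, Nat.cast_one, ← add_assoc, add_sub_cancel_right]
    simp only [lyapunov] at this ⊢
    linarith
  have hs := Finset.sum_le_sum hpt
  rw [Finset.sum_add_distrib, Finset.sum_add_distrib, Finset.sum_add_distrib, ← Finset.mul_sum,
    ← Finset.mul_sum, Finset.sum_add_distrib, Finset.sum_range_sub, hG, hG, Nat.cast_zero,
    add_zero] at hs
  have hF : ∀ s : ℤ, |entropyNumFlux u σ R ν q s + jumpNumFlux κ ℓ₂ u σ ν' μ (s - 1)|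
      ≤ 20 * U ^ 2 + B := by
    intro s
    have := h.abs_fluxes_le (s - 1)
    rwa [sub_add_cancel] at this
  have hV : ∀ s : ℤ, max (v s - v (s - 1)) 0 ^ 2 ≤ 4 * U ^ 2 := by
    intro s
    have h1 := abs_le.1 (h.abs_v_le s)
    have h2 := abs_le.1 (h.abs_v_le (s - 1))
    have h3 : max (v s - v (s - 1)) 0 ≤ 2 * U := max_le (by linarith) (by linarith)
    calc _ ≤ (2 * U) ^ 2 := by gcongr
      _ = _ := by ring
  have f1 := abs_le.1 (hF (a + L))
  have f2 := abs_le.1 (hF a)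
  have f3 := hV (a + L)
  have f4 := sq_nonneg (max (v a - v (a - 1)) 0)
  have hUU := sq_nonneg U
  linarith

end StaggeredStep

end

/-! ### Consequences of the flux hypotheses. -/

namespace FluxHypotheses

variable {f : ℝ → ℝ → ℝ} {klo khi ulo uhi γ₁ γ₂ : ℝ}

theorem hasDerivWithinAt (hf : FluxHypotheses f klo khi ulo uhi γ₁ γ₂) {k u : ℝ}
    (hk : k ∈ Set.Icc klo khi) (hu : u ∈ Set.Icc ulo uhi) :
    HasDerivWithinAt (f k) (fluxDu f ulo uhi k u) (Set.Icc ulo uhi) u :=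
  (((hf.contDiffOn_u k hk).differentiableOn (by norm_num)) u hu).hasDerivWithinAt

theorem hasDerivWithinAt_fluxDu (hf : FluxHypotheses f klo khi ulo uhi γ₁ γ₂) (hlt : ulo < uhi)
    {k u : ℝ} (hk : k ∈ Set.Icc klo khi) (hu : u ∈ Set.Icc ulo uhi) :
    HasDerivWithinAt (fluxDu f ulo uhi k) (fluxDuu f ulo uhi k u) (Set.Icc ulo uhi) u := by
  have h := ((hf.contDiffOn_u k hk).differentiableOn_iteratedDerivWithin (m := 1)
    (by norm_num) (uniqueDiffOn_Icc hlt)) u hu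
  have h2 := h.hasDerivWithinAt
  rw [← iteratedDerivWithin_succ] at h2
  rw [iteratedDerivWithin_one] at h2
  exact h2

theorem hasDerivAt (hf : FluxHypotheses f klo khi ulo uhi γ₁ γ₂) {k u : ℝ}
    (hk : k ∈ Set.Icc klo khi) (hu : u ∈ Set.Ioo ulo uhi) :
    HasDerivAt (f k) (fluxDu f ulo uhi k u) u :=
  (hf.hasDerivWithinAt hk (Set.Ioo_subset_Icc_self hu)).hasDerivAt (Icc_mem_nhds hu.1 hu.2)

theorem hasDerivAt_fluxDu (hf : FluxHypotheses f klo khi ulo uhi γ₁ γ₂) (hlt : ulo < uhi)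
    {k u : ℝ} (hk : k ∈ Set.Icc klo khi) (hu : u ∈ Set.Ioo ulo uhi) :
    HasDerivAt (fluxDu f ulo uhi k) (fluxDuu f ulo uhi k u) u :=
  (hf.hasDerivWithinAt_fluxDu hlt hk (Set.Ioo_subset_Icc_self hu)).hasDerivAt
    (Icc_mem_nhds hu.1 hu.2)

theorem continuousOn (hf : FluxHypotheses f klo khi ulo uhi γ₁ γ₂) {k : ℝ}
    (hk : k ∈ Set.Icc klo khi) : ContinuousOn (f k) (Set.Icc ulo uhi) :=
  (hf.contDiffOn_u k hk).continuousOn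

theorem continuousOn_fluxDu (hf : FluxHypotheses f klo khi ulo uhi γ₁ γ₂) (hlt : ulo < uhi)
    {k : ℝ} (hk : k ∈ Set.Icc klo khi) : ContinuousOn (fluxDu f ulo uhi k) (Set.Icc ulo uhi) :=
  fun _ hu => (hf.hasDerivWithinAt_fluxDu hlt hk hu).continuousWithinAt

theorem exists_fluxDu_eq_slope (hf : FluxHypotheses f klo khi ulo uhi γ₁ γ₂) {k u w : ℝ}
    (hk : k ∈ Set.Icc klo khi) (hu : u ∈ Set.Icc ulo uhi) (hw : w ∈ Set.Icc ulo uhi) :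
    ∃ ξ ∈ Set.uIcc u w, f k w - f k u = fluxDu f ulo uhi k ξ * (w - u) := by
  have key : ∀ u w : ℝ, u ∈ Set.Icc ulo uhi → w ∈ Set.Icc ulo uhi → u < w →
      ∃ ξ ∈ Set.Icc u w, f k w - f k u = fluxDu f ulo uhi k ξ * (w - u) := by
    intro u w hu hw huw
    obtain ⟨ξ, hξ, h⟩ := exists_hasDerivAt_eq_slope (f k) (fluxDu f ulo uhi k) huw
      ((hf.continuousOn hk).mono (Set.Icc_subset_Icc hu.1 hw.2))
      (fun x hx => hf.hasDerivAt hk ⟨hu.1.trans_lt hx.1, hx.2.trans_le hw.2⟩)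
    refine ⟨ξ, Set.Ioo_subset_Icc_self hξ, ?_⟩
    rw [h, div_mul_cancel₀ _ (sub_ne_zero.2 huw.ne')]
  rcases lt_trichotomy u w with h | h | h
  · obtain ⟨ξ, hξ, h'⟩ := key u w hu hw h
    exact ⟨ξ, by rwa [Set.uIcc_of_le h.le], h'⟩
  · exact ⟨u, Set.left_mem_uIcc, by simp [h]⟩
  · obtain ⟨ξ, hξ, h'⟩ := key w u hw hu h
    exact ⟨ξ, by rwa [Set.uIcc_of_ge h.le], by linarith⟩

theorem fluxDu_sub_mem (hf : FluxHypotheses f klo khi ulo uhi γ₁ γ₂) (hlt : ulo < uhi)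
    {k u w : ℝ} (hk : k ∈ Set.Icc klo khi) (hu : u ∈ Set.Icc ulo uhi) (hw : w ∈ Set.Icc ulo uhi)
    (huw : u ≤ w) :
    γ₁ * (w - u) ≤ fluxDu f ulo uhi k w - fluxDu f ulo uhi k u ∧
      fluxDu f ulo uhi k w - fluxDu f ulo uhi k u ≤ γ₂ * (w - u) := by
  rcases huw.eq_or_lt with rfl | huw
  · simp
  obtain ⟨ξ, hξ, h⟩ := exists_hasDerivAt_eq_slope (fluxDu f ulo uhi k) (fluxDuu f ulo uhi k) huw
    ((hf.continuousOn_fluxDu hlt hk).mono (Set.Icc_subset_Icc hu.1 hw.2))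
    (fun x hx => hf.hasDerivAt_fluxDu hlt hk ⟨hu.1.trans_lt hx.1, hx.2.trans_le hw.2⟩)
  have hξI : ξ ∈ Set.Icc ulo uhi := ⟨hu.1.trans hξ.1.le, hξ.2.le.trans hw.2⟩
  have h1 := hf.fuu_ge k hk ξ hξI
  have h2 := hf.fuu_le k hk ξ hξI
  rw [h] at h1 h2
  have hpos := sub_pos.2 huw
  exact ⟨(le_div_iff₀ hpos).1 h1, (div_le_iff₀ hpos).1 h2⟩

theorem gamma_le (hf : FluxHypotheses f klo khi ulo uhi γ₁ γ₂) (hlt : ulo < uhi)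
    (hk : klo ≤ khi) : γ₁ ≤ γ₂ :=
  (hf.fuu_ge klo ⟨le_rfl, hk⟩ ulo ⟨le_rfl, hlt.le⟩).trans
    (hf.fuu_le klo ⟨le_rfl, hk⟩ ulo ⟨le_rfl, hlt.le⟩)

theorem abs_fluxDu_sub_le (hf : FluxHypotheses f klo khi ulo uhi γ₁ γ₂) (hlt : ulo < uhi)
    {k u w : ℝ} (hk : k ∈ Set.Icc klo khi) (hu : u ∈ Set.Icc ulo uhi) (hw : w ∈ Set.Icc ulo uhi) :
    |fluxDu f ulo uhi k w - fluxDu f ulo uhi k u| ≤ γ₂ * |w - u| := by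
  have h0 := hf.gamma_pos
  rcases le_total u w with h | h
  · obtain ⟨h1, h2⟩ := hf.fluxDu_sub_mem hlt hk hu hw h
    rw [abs_of_nonneg (sub_nonneg.2 h), abs_of_nonneg]
    · exact h2
    · exact (mul_nonneg h0.le (sub_nonneg.2 h)).trans h1
  · obtain ⟨h1, h2⟩ := hf.fluxDu_sub_mem hlt hk hw hu h
    rw [abs_sub_comm, abs_sub_comm w u, abs_of_nonneg (sub_nonneg.2 h), abs_of_nonneg]
    · exact h2
    · exact (mul_nonneg h0.le (sub_nonneg.2 h)).trans h1

end FluxHypotheses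

/-- A primitive of `f k` on `[ulo, uhi]`, extended by constants of the integrand. -/
noncomputable def fluxPrimitive (f : ℝ → ℝ → ℝ) (ulo uhi k u : ℝ) : ℝ :=
  ∫ x in ulo..u, f k (max ulo (min uhi x))

theorem clamp_mem {ulo uhi : ℝ} (h : ulo ≤ uhi) (x : ℝ) :
    max ulo (min uhi x) ∈ Set.Icc ulo uhi :=
  ⟨le_max_left _ _, max_le h (min_le_left _ _)⟩

theorem clamp_eq {ulo uhi x : ℝ} (h : x ∈ Set.Icc ulo uhi) : max ulo (min uhi x) = x := by
  rw [min_eq_right h.2, max_eq_right h.1]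

namespace FluxHypotheses

variable {f : ℝ → ℝ → ℝ} {klo khi ulo uhi γ₁ γ₂ : ℝ}

theorem continuous_clamp (hf : FluxHypotheses f klo khi ulo uhi γ₁ γ₂) (hlt : ulo < uhi)
    {k : ℝ} (hk : k ∈ Set.Icc klo khi) : Continuous fun x => f k (max ulo (min uhi x)) :=
  (hf.continuousOn hk).comp_continuous (by fun_prop) (clamp_mem hlt.le)

theorem hasDerivAt_fluxPrimitive (hf : FluxHypotheses f klo khi ulo uhi γ₁ γ₂) (hlt : ulo < uhi)
    {k u : ℝ} (hk : k ∈ Set.Icc klo khi) (hu : u ∈ Set.Icc ulo uhi) :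
    HasDerivAt (fluxPrimitive f ulo uhi k) (f k u) u := by
  have := ((hf.continuous_clamp hlt hk).integral_hasStrictDerivAt ulo u).hasDerivAt
  rwa [clamp_eq hu] at this

/-- Lower bound for the error of the trapezoidal rule of a uniformly convex function. -/
theorem le_trapezoid_sub (hf : FluxHypotheses f klo khi ulo uhi γ₁ γ₂) (hlt : ulo < uhi)
    {k u w : ℝ} (hk : k ∈ Set.Icc klo khi) (hu : u ∈ Set.Icc ulo uhi) (hw : w ∈ Set.Icc ulo uhi)
    (huw : u ≤ w) :
    γ₁ / 6 * (w - u) ^ 3 ≤ (f k u + f k w) * (w - u)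
      - 2 * (fluxPrimitive f ulo uhi k w - fluxPrimitive f ulo uhi k u) := by
  have hsub : Set.Icc u w ⊆ Set.Icc ulo uhi := Set.Icc_subset_Icc hu.1 hw.2
  have hint : ∀ x ∈ Set.Ioo u w, x ∈ Set.Ioo ulo uhi := fun x hx =>
    ⟨hu.1.trans_lt hx.1, hx.2.trans_le hw.2⟩
  have hfc := (hf.continuousOn hk).mono hsub
  have hfc' := (hf.continuousOn_fluxDu hlt hk).mono hsub
  have hGc : ContinuousOn (fluxPrimitive f ulo uhi k) (Set.Icc u w) := fun x hx =>
    (hf.hasDerivAt_fluxPrimitive hlt hk (hsub hx)).continuousAt.continuousWithinAt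
  -- As a function of the right end point, the trapezoidal error has derivative f_u(t)(t - u) -
  -- (f(t) - f(u)), whose own derivative is f_uu(t)(t - u) ≥ γ₁(t - u). Two integrations give γ₁/6.
  have h1 : MonotoneOn (fun t => fluxDu f ulo uhi k t * (t - u) - (f k t - f k u)
      - γ₁ / 2 * (t - u) ^ 2) (Set.Icc u w) := by
    apply monotoneOn_of_hasDerivWithinAt_nonneg (convex_Icc u w)
      (f' := fun t => fluxDuu f ulo uhi k t * (t - u) - γ₁ * (t - u))
    · fun_prop
    · intro x hx
      rw [interior_Icc] at hx ⊢
      have d1 := hf.hasDerivAt_fluxDu hlt hk (hint x hx)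
      have d2 := hf.hasDerivAt hk (hint x hx)
      have d3 : HasDerivAt (fun t : ℝ => t - u) 1 x := (hasDerivAt_id x).sub_const u
      have := ((d1.mul d3).sub (d2.sub_const (f k u))).sub ((d3.pow 2).const_mul (γ₁ / 2))
      refine (this.congr_deriv ?_).hasDerivWithinAt
      norm_num
      ring
    · intro x hx
      rw [interior_Icc] at hx
      have := hf.fuu_ge k hk x (Set.Ioo_subset_Icc_self (hint x hx))
      have := mul_le_mul_of_nonneg_right this (sub_pos.2 hx.1).le
      linarith
  have h2 : MonotoneOn (fun t => (f k u + f k t) * (t - u)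
      - 2 * (fluxPrimitive f ulo uhi k t - fluxPrimitive f ulo uhi k u) - γ₁ / 6 * (t - u) ^ 3)
      (Set.Icc u w) := by
    apply monotoneOn_of_hasDerivWithinAt_nonneg (convex_Icc u w)
      (f' := fun t => fluxDu f ulo uhi k t * (t - u) - (f k t - f k u) - γ₁ / 2 * (t - u) ^ 2)
    · fun_prop
    · intro x hx
      rw [interior_Icc] at hx ⊢
      have d2 := hf.hasDerivAt hk (hint x hx)
      have d3 : HasDerivAt (fun t : ℝ => t - u) 1 x := (hasDerivAt_id x).sub_const u
      have d4 := hf.hasDerivAt_fluxPrimitive hlt hk (Set.Ioo_subset_Icc_self (hint x hx))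
      have := (((d2.const_add (f k u)).mul d3).sub
        ((d4.sub_const (fluxPrimitive f ulo uhi k u)).const_mul 2)).sub
        ((d3.pow 3).const_mul (γ₁ / 6))
      refine (this.congr_deriv ?_).hasDerivWithinAt
      norm_num
      ring
    · intro x hx
      rw [interior_Icc] at hx
      have := h1 (Set.left_mem_Icc.2 huw) (Set.Ioo_subset_Icc_self hx) hx.1.le
      simpa using this
  have := h2 (Set.left_mem_Icc.2 huw) (Set.right_mem_Icc.2 huw) huw
  simp only [sub_self, mul_zero, ne_eq, OfNat.ofNat_ne_zero, not_false_eq_true, zero_pow] at this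
  linarith

/-- Upper bound for the error of the trapezoidal rule of a convex function. -/
theorem trapezoid_sub_le (hf : FluxHypotheses f klo khi ulo uhi γ₁ γ₂) (hlt : ulo < uhi)
    {k u w : ℝ} (hk : k ∈ Set.Icc klo khi) (hu : u ∈ Set.Icc ulo uhi) (hw : w ∈ Set.Icc ulo uhi)
    (huw : u ≤ w) :
    (f k u + f k w) * (w - u) - 2 * (fluxPrimitive f ulo uhi k w - fluxPrimitive f ulo uhi k u) ≤
      (w - u) ^ 2 * (fluxDu f ulo uhi k w - fluxDu f ulo uhi k u) / 2 := by
  have hsub : Set.Icc u w ⊆ Set.Icc ulo uhi := Set.Icc_subset_Icc hu.1 hw.2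
  have hint : ∀ x ∈ Set.Ioo u w, x ∈ Set.Ioo ulo uhi := fun x hx =>
    ⟨hu.1.trans_lt hx.1, hx.2.trans_le hw.2⟩
  have hfc := (hf.continuousOn hk).mono hsub
  have hfc' := (hf.continuousOn_fluxDu hlt hk).mono hsub
  have hGc : ContinuousOn (fluxPrimitive f ulo uhi k) (Set.Icc u w) := fun x hx =>
    (hf.hasDerivAt_fluxPrimitive hlt hk (hsub hx)).continuousAt.continuousWithinAt
  -- The bound is by the actual speed difference, not by γ₂(w - u), so that the spreading of the
  -- jump absorbs it whatever the ratio γ₂/γ₁.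
  have h2 : MonotoneOn (fun t => (t - u) ^ 2 * (fluxDu f ulo uhi k t - fluxDu f ulo uhi k u) / 2
      - ((f k u + f k t) * (t - u)
      - 2 * (fluxPrimitive f ulo uhi k t - fluxPrimitive f ulo uhi k u))) (Set.Icc u w) := by
    apply monotoneOn_of_hasDerivWithinAt_nonneg (convex_Icc u w)
      (f' := fun t => (t - u) ^ 2 * fluxDuu f ulo uhi k t / 2
        + (f k t - f k u - fluxDu f ulo uhi k u * (t - u)))
    · fun_prop
    · intro x hx
      rw [interior_Icc] at hx ⊢
      have d1 := hf.hasDerivAt_fluxDu hlt hk (hint x hx)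
      have d2 := hf.hasDerivAt hk (hint x hx)
      have d3 : HasDerivAt (fun t : ℝ => t - u) 1 x := (hasDerivAt_id x).sub_const u
      have d4 := hf.hasDerivAt_fluxPrimitive hlt hk (Set.Ioo_subset_Icc_self (hint x hx))
      have := (((d3.pow 2).mul (d1.sub_const (fluxDu f ulo uhi k u))).div_const 2).sub
        (((d2.const_add (f k u)).mul d3).sub
        ((d4.sub_const (fluxPrimitive f ulo uhi k u)).const_mul 2))
      refine (this.congr_deriv ?_).hasDerivWithinAt
      norm_num
      ring
    · intro x hx
      rw [interior_Icc] at hx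
      have hxI := Set.Ioo_subset_Icc_self (hint x hx)
      obtain ⟨ξ, hξ, h⟩ := hf.exists_fluxDu_eq_slope hk hu hxI
      rw [Set.uIcc_of_le hx.1.le] at hξ
      have hm := (hf.fluxDu_sub_mem hlt hk hu ⟨hu.1.trans hξ.1, hξ.2.trans hxI.2⟩ hξ.1).1
      have hm' : fluxDu f ulo uhi k u ≤ fluxDu f ulo uhi k ξ := by
        have := mul_nonneg hf.gamma_pos.le (sub_nonneg.2 hξ.1)
        linarith
      have h0 := hf.gamma_pos.le.trans (hf.fuu_ge k hk x hxI)
      have h1 := mul_le_mul_of_nonneg_right hm' (sub_pos.2 hx.1).le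
      have h3 : 0 ≤ (x - u) ^ 2 * fluxDuu f ulo uhi k x / 2 := by positivity
      linarith
  have := h2 (Set.left_mem_Icc.2 huw) (Set.right_mem_Icc.2 huw) huw
  simp only [sub_self, mul_zero, ne_eq, OfNat.ofNat_ne_zero, not_false_eq_true, zero_pow,
    zero_div] at this
  linarith

/-- The flux is affine in `k`. -/
theorem eq_affine (hf : FluxHypotheses f klo khi ulo uhi γ₁ γ₂) (hk' : klo < khi) {k u : ℝ}
    (hk : k ∈ Set.Icc klo khi) (hu : u ∈ Set.Icc ulo uhi) :
    f k u = f klo u + (k - klo) / (khi - klo) * (f khi u - f klo u) := by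
  set K := Set.Icc klo khi with hK
  set h : ℝ → ℝ := fun k => f k u with hh
  have hC := hf.contDiffOn_k u hu
  have hun : UniqueDiffOn ℝ K := uniqueDiffOn_Icc hk'
  have hd1 : DifferentiableOn ℝ h K := hC.differentiableOn (by norm_num)
  have hd2 : DifferentiableOn ℝ (derivWithin h K) K := by
    have := hC.differentiableOn_iteratedDerivWithin (m := 1) (by norm_num) hun
    rwa [iteratedDerivWithin_one] at this
  have hz : ∀ x ∈ Set.Ico klo khi, derivWithin (derivWithin h K) K x = 0 := by
    intro x hx
    have := hf.fkk_eq_zero u hu x (Set.Ico_subset_Icc_self hx)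
    rw [iteratedDerivWithin_succ, iteratedDerivWithin_one] at this
    exact this
  have hc := constant_of_derivWithin_zero hd2 hz
  set c := derivWithin h K klo with hcdef
  have hd3 : DifferentiableOn ℝ (fun x => h x - c * x) K := hd1.sub (by fun_prop)
  have hz' : ∀ x ∈ Set.Ico klo khi, derivWithin (fun x => h x - c * x) K x = 0 := by
    intro x hx
    have hxK := Set.Ico_subset_Icc_self hx
    have d1 := (hd1 x hxK).hasDerivWithinAt
    have d2 : HasDerivWithinAt (fun x : ℝ => c * x) (c * 1) K x :=
      (hasDerivWithinAt_id x K).const_mul c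
    have : derivWithin (fun x => h x - c * x) K x = derivWithin h K x - c * 1 :=
      (d1.sub d2).derivWithin (hun x hxK)
    rw [this, hc x hxK, mul_one, sub_self]
  have hc' := constant_of_derivWithin_zero hd3 hz'
  have e1 := hc' k hk
  have e2 := hc' khi (Set.right_mem_Icc.2 hk'.le)
  simp only [hh] at e1 e2
  have hne : khi - klo ≠ 0 := (sub_pos.2 hk').ne'
  have e3 : f khi u - f klo u = c * (khi - klo) := by linarith
  rw [e3]
  field_simp
  linarith

theorem fluxDu_eq_affine (hf : FluxHypotheses f klo khi ulo uhi γ₁ γ₂) (hlt : ulo < uhi)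
    (hk' : klo < khi) {k u : ℝ} (hk : k ∈ Set.Icc klo khi) (hu : u ∈ Set.Icc ulo uhi) :
    fluxDu f ulo uhi k u = fluxDu f ulo uhi klo u
      + (k - klo) / (khi - klo) * (fluxDu f ulo uhi khi u - fluxDu f ulo uhi klo u) := by
  have d1 := hf.hasDerivWithinAt (Set.left_mem_Icc.2 hk'.le) hu
  have d2 := hf.hasDerivWithinAt (Set.right_mem_Icc.2 hk'.le) hu
  have d3 := (d1.add ((d2.sub d1).const_mul ((k - klo) / (khi - klo)))).congr_of_mem
    (f₁ := f k) (fun x hx => by simpa using hf.eq_affine hk' hk hx) hu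
  exact d3.derivWithin (uniqueDiffOn_Icc hlt u hu)

theorem abs_sub_le (hf : FluxHypotheses f klo khi ulo uhi γ₁ γ₂) {k u w M : ℝ}
    (hM : ∀ k ∈ Set.Icc klo khi, ∀ u ∈ Set.Icc ulo uhi, |fluxDu f ulo uhi k u| ≤ M)
    (hk : k ∈ Set.Icc klo khi) (hu : u ∈ Set.Icc ulo uhi) (hw : w ∈ Set.Icc ulo uhi) :
    |f k w - f k u| ≤ M * |w - u| := by
  obtain ⟨ξ, hξ, h⟩ := hf.exists_fluxDu_eq_slope hk hu hw
  rw [h, abs_mul]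
  exact mul_le_mul_of_nonneg_right (hM k hk ξ (Set.ordConnected_Icc.uIcc_subset hu hw hξ))
    (abs_nonneg _)

/-- Lipschitz dependence on `k` of the flux and of its `u`-derivative. -/
theorem exists_lipschitz_k (hf : FluxHypotheses f klo khi ulo uhi γ₁ γ₂) (hlt : ulo < uhi) {M : ℝ}
    (hM : ∀ k ∈ Set.Icc klo khi, ∀ u ∈ Set.Icc ulo uhi, |fluxDu f ulo uhi k u| ≤ M) :
    ∃ L : ℝ, 0 ≤ L ∧ ∀ k₁ ∈ Set.Icc klo khi, ∀ k₂ ∈ Set.Icc klo khi, ∀ u ∈ Set.Icc ulo uhi,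
      |f k₂ u - f k₁ u| ≤ L * |k₂ - k₁| ∧
      |fluxDu f ulo uhi k₂ u - fluxDu f ulo uhi k₁ u| ≤ L * |k₂ - k₁| := by
  rcases lt_or_ge klo khi with hk' | hk'
  · have hlo : klo ∈ Set.Icc klo khi := Set.left_mem_Icc.2 hk'.le
    have hhi : khi ∈ Set.Icc klo khi := Set.right_mem_Icc.2 hk'.le
    have hulo : ulo ∈ Set.Icc ulo uhi := Set.left_mem_Icc.2 hlt.le
    have hM0 : 0 ≤ M := (abs_nonneg _).trans (hM klo hlo ulo hulo)
    have hpos := sub_pos.2 hk'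
    have hupos := sub_pos.2 hlt
    have key : ∀ k₁ k₂ a b A : ℝ, |b - a| ≤ A →
        |(a + (k₂ - klo) / (khi - klo) * (b - a)) - (a + (k₁ - klo) / (khi - klo) * (b - a))| ≤
          A / (khi - klo) * |k₂ - k₁| := by
      intro k₁ k₂ a b A hA
      have : (a + (k₂ - klo) / (khi - klo) * (b - a)) - (a + (k₁ - klo) / (khi - klo) * (b - a))
          = (b - a) / (khi - klo) * (k₂ - k₁) := by ring
      rw [this, abs_mul, abs_div, abs_of_pos hpos]
      gcongr
    -- The increment in k over the whole interval is at most 2M(uhi - ulo) for f, because the fluxes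
    -- agree at ulo, and at most 2M for f_u.
    refine ⟨2 * M * (1 + (uhi - ulo)) / (khi - klo), by positivity, ?_⟩
    intro k₁ h₁ k₂ h₂ u hu
    constructor
    · rw [hf.eq_affine hk' h₁ hu, hf.eq_affine hk' h₂ hu]
      apply key
      have a1 := hf.abs_sub_le hM hlo hulo hu
      have a2 := hf.abs_sub_le hM hhi hulo hu
      have a3 := hf.eq_at_bot khi hhi klo hlo
      have a4 : |u - ulo| ≤ uhi - ulo := abs_le.2 ⟨by linarith [hu.1], by linarith [hu.2]⟩
      have a5 : M * |u - ulo| ≤ M * (uhi - ulo) := by gcongr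
      rw [abs_le] at a1 a2 ⊢
      rw [a3] at a2
      constructor <;> linarith
    · rw [hf.fluxDu_eq_affine hlt hk' h₁ hu, hf.fluxDu_eq_affine hlt hk' h₂ hu]
      apply key
      have a1 := hM khi hhi u hu
      have a2 := hM klo hlo u hu
      have a3 := mul_nonneg hM0 hupos.le
      exact (abs_sub _ _).trans (by linarith)
  · refine ⟨0, le_rfl, ?_⟩
    intro k₁ h₁ k₂ h₂ u _
    have : k₁ = k₂ := by linarith [h₁.1, h₁.2, h₂.1, h₂.2]
    subst this
    simp

end FluxHypotheses

/-! ### The minmod limiter. -/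

theorem minmod_average_of_pos {a c : ℝ} (ha : 0 < a) (hc : 0 < c) :
    minmod a (1 / 2 * (a + c)) c = min a c := by
  have hb : 0 < 1 / 2 * (a + c) := by positivity
  rw [minmod, Real.sign_of_pos ha, Real.sign_of_pos hb, Real.sign_of_pos hc, if_pos ⟨rfl, rfl⟩,
    abs_of_pos ha, abs_of_pos hb, abs_of_pos hc, one_mul]
  rcases le_total a c with h | h
  · rw [min_eq_left h, min_eq_left]; exact le_min (by linarith) h
  · rw [min_eq_right h, min_eq_right (by linarith : c ≤ 1 / 2 * (a + c)), min_eq_right h]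

theorem minmod_average_of_neg {a c : ℝ} (ha : a < 0) (hc : c < 0) :
    minmod a (1 / 2 * (a + c)) c = max a c := by
  have hb : 1 / 2 * (a + c) < 0 := by linarith
  rw [minmod, Real.sign_of_neg ha, Real.sign_of_neg hb, Real.sign_of_neg hc, if_pos ⟨rfl, rfl⟩,
    abs_of_neg ha, abs_of_neg hb, abs_of_neg hc]
  rcases le_total a c with h | h
  · rw [max_eq_right h, min_eq_right (by linarith : -c ≤ -(1 / 2 * (a + c))),
      min_eq_right (by linarith)]
    ring
  · rw [max_eq_left h, min_eq_left (le_min (by linarith) (by linarith))]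
    ring

theorem minmod_eq_zero_of_mul_nonpos {a b c : ℝ} (h : a * c ≤ 0) : minmod a b c = 0 := by
  unfold minmod
  split_ifs with hs
  · obtain ⟨h1, h2⟩ := hs
    rcases lt_trichotomy a 0 with ha | ha | ha
    · rw [Real.sign_of_neg ha] at h1
      rw [← h1] at h2
      have hc : 0 ≤ c := by by_contra! hc; nlinarith
      rcases hc.eq_or_lt with rfl | hc
      · norm_num at h2
      · rw [Real.sign_of_pos hc] at h2; norm_num at h2
    · rw [ha, Real.sign_zero, zero_mul]
    · rw [Real.sign_of_pos ha] at h1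
      rw [← h1] at h2
      have hc : c ≤ 0 := by by_contra! hc; nlinarith
      rcases hc.eq_or_lt with rfl | hc
      · norm_num at h2
      · rw [Real.sign_of_neg hc] at h2; norm_num at h2
  · rfl

/-- The average lies between a and c, so it is never strictly the smallest and minmod only compares
the two one-sided jumps. The exact formula for the positive part is what makes differences of
adjacent upward jumps controllable. -/
theorem minmod_average_spec (a c : ℝ) :
    BetweenZero (minmod a (1 / 2 * (a + c)) c) a ∧ BetweenZero (minmod a (1 / 2 * (a + c)) c) c ∧
      max (minmod a (1 / 2 * (a + c)) c) 0 = min (max a 0) (max c 0) := by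
  by_cases h : a * c ≤ 0
  · rw [minmod_eq_zero_of_mul_nonpos h]
    have hb : ∀ x : ℝ, BetweenZero 0 x := fun x => by
      rcases le_total 0 x with hx | hx
      · exact Or.inl ⟨le_rfl, hx⟩
      · exact Or.inr ⟨hx, le_rfl⟩
    refine ⟨hb a, hb c, ?_⟩
    rcases le_or_gt a 0 with ha | ha
    · rw [max_eq_right ha, max_self, min_eq_left (le_max_right _ _)]
    · have hc : c ≤ 0 := by by_contra! hc; nlinarith
      rw [max_eq_right hc, max_self, min_eq_right (le_max_right _ _)]
  · rcases pos_and_pos_or_neg_and_neg_of_mul_pos (not_le.1 h) with ⟨ha, hc⟩ | ⟨ha, hc⟩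
    · rw [minmod_average_of_pos ha hc, max_eq_left ha.le, max_eq_left hc.le,
        max_eq_left (le_min ha.le hc.le)]
      exact ⟨Or.inl ⟨le_min ha.le hc.le, min_le_left _ _⟩,
        Or.inl ⟨le_min ha.le hc.le, min_le_right _ _⟩, rfl⟩
    · rw [minmod_average_of_neg ha hc, max_eq_right ha.le, max_eq_right hc.le,
        max_eq_right (max_le ha.le hc.le), min_self]
      exact ⟨Or.inr ⟨le_max_left _ _, max_le ha.le hc.le⟩,
        Or.inr ⟨le_max_right _ _, max_le ha.le hc.le⟩, rfl⟩

/-- The limited slopes of a sequence of consecutive cell values. -/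
noncomputable def limitedSlope (u : ℤ → ℝ) (j : ℤ) : ℝ :=
  minmod (u (j + 1) - u j) (1 / 2 * ((u (j + 1) - u j) + (u j - u (j - 1)))) (u j - u (j - 1))

theorem limitedSlope_right (u : ℤ → ℝ) (j : ℤ) :
    BetweenZero (limitedSlope u j) (u (j + 1) - u j) :=
  (minmod_average_spec _ _).1

theorem limitedSlope_left (u : ℤ → ℝ) (j : ℤ) :
    BetweenZero (limitedSlope u (j + 1)) (u (j + 1) - u j) := by
  have := (minmod_average_spec (u (j + 1 + 1) - u (j + 1)) (u (j + 1) - u (j + 1 - 1))).2.1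
  rw [add_sub_cancel_right] at this
  rwa [limitedSlope, add_sub_cancel_right]

theorem posPart_limitedSlope (u : ℤ → ℝ) (j : ℤ) : max (limitedSlope u (j + 1)) 0 =
    min (max (u (j + 1 + 1) - u (j + 1)) 0) (max (u (j + 1) - u j) 0) := by
  have := (minmod_average_spec (u (j + 1 + 1) - u (j + 1)) (u (j + 1) - u (j + 1 - 1))).2.2
  rw [add_sub_cancel_right] at this
  rwa [limitedSlope, add_sub_cancel_right]

/-! ### The scheme on consecutive cells: maximum principle and verification of the abstract step. -/

/-- Mid-time values of consecutive cells, with their own values `K` of the coefficient. -/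
noncomputable def predictor (f : ℝ → ℝ → ℝ) (ulo uhi lam : ℝ) (K u : ℤ → ℝ) (j : ℤ) : ℝ :=
  u j - lam / 2 * fluxDu f ulo uhi (K j) (u j) * limitedSlope u j

/-- One step of the scheme for consecutive cells. -/
noncomputable def corrector (f : ℝ → ℝ → ℝ) (ulo uhi lam : ℝ) (K u : ℤ → ℝ) (j : ℤ) : ℝ :=
  (u j + u (j + 1)) / 2 - (limitedSlope u (j + 1) - limitedSlope u j) / 8
    - lam * (f (K (j + 1)) (predictor f ulo uhi lam K u (j + 1))
      - f (K j) (predictor f ulo uhi lam K u j))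

section

variable {f : ℝ → ℝ → ℝ} {klo khi ulo uhi γ₁ γ₂ lam κ : ℝ} {K u : ℤ → ℝ}

theorem abs_predictor_sub_le (hlam : 0 < lam)
    (hκ : ∀ k ∈ Set.Icc klo khi, ∀ u ∈ Set.Icc ulo uhi, lam * |fluxDu f ulo uhi k u| ≤ κ)
    (hK : ∀ j, K j ∈ Set.Icc klo khi) (hu : ∀ j, u j ∈ Set.Icc ulo uhi) (j : ℤ) :
    |predictor f ulo uhi lam K u j - u j| ≤ κ / 2 * |limitedSlope u j| := by
  rw [predictor, show ∀ a b : ℝ, a - b - a = -b by intros; ring, abs_neg, abs_mul, abs_mul,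
    abs_of_pos (by positivity : 0 < lam / 2)]
  have := hκ (K j) (hK j) (u j) (hu j)
  gcongr
  linarith

/-- The predictor moves by at most the limited slope, which exceeds neither adjacent jump; it
therefore stays between the two neighbouring cell values or at the old one. -/
theorem predictor_mem (hlam : 0 < lam) (hκ1 : κ ≤ 1)
    (hκ : ∀ k ∈ Set.Icc klo khi, ∀ u ∈ Set.Icc ulo uhi, lam * |fluxDu f ulo uhi k u| ≤ κ)
    (hK : ∀ j, K j ∈ Set.Icc klo khi) (hu : ∀ j, u j ∈ Set.Icc ulo uhi) (j : ℤ) :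
    predictor f ulo uhi lam K u j ∈ Set.Icc ulo uhi := by
  have h1 := abs_predictor_sub_le hlam hκ hK hu j
  have h2 : |predictor f ulo uhi lam K u j - u j| ≤ |limitedSlope u j| := by
    have := mul_le_mul_of_nonneg_right hκ1 (abs_nonneg (limitedSlope u j))
    linarith [abs_nonneg (limitedSlope u j)]
  have hr := limitedSlope_right u j
  have hl := limitedSlope_left u (j - 1)
  rw [sub_add_cancel] at hl
  have h3 := hu (j - 1)
  have h4 := hu (j + 1)
  rcases le_total 0 (limitedSlope u j) with h | h
  · rw [abs_of_nonneg h, abs_le] at h2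
    constructor
    · rcases hl with ⟨_, _⟩ | ⟨_, _⟩ <;> linarith [h3.1, (hu j).1]
    · rcases hr with ⟨_, _⟩ | ⟨_, _⟩ <;> linarith [h4.2, (hu j).2]
  · rw [abs_of_nonpos h, abs_le] at h2
    constructor
    · rcases hr with ⟨_, _⟩ | ⟨_, _⟩ <;> linarith [h4.1, (hu j).1]
    · rcases hl with ⟨_, _⟩ | ⟨_, _⟩ <;> linarith [h3.2, (hu j).2]

/-- The maximum principle for one step of the scheme. -/
theorem corrector_mem (hf : FluxHypotheses f klo khi ulo uhi γ₁ γ₂) (hlt : ulo < uhi)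
    (hlam : 0 < lam) (hκ1 : κ ≤ 1 / 7500)
    (hκ : ∀ k ∈ Set.Icc klo khi, ∀ u ∈ Set.Icc ulo uhi, lam * |fluxDu f ulo uhi k u| ≤ κ)
    (hK : ∀ j, K j ∈ Set.Icc klo khi) (hu : ∀ j, u j ∈ Set.Icc ulo uhi) (j : ℤ) :
    corrector f ulo uhi lam K u j ∈ Set.Icc ulo uhi := by
  have hκ0 : 0 ≤ κ := (by positivity : 0 ≤ lam * |fluxDu f ulo uhi (K j) (u j)|).trans
    (hκ (K j) (hK j) (u j) (hu j))
  set m := predictor f ulo uhi lam K u with hm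
  have hmem := predictor_mem hlam (by linarith) hκ hK hu
  have hM : ∀ k ∈ Set.Icc klo khi, ∀ u ∈ Set.Icc ulo uhi, |fluxDu f ulo uhi k u| ≤ κ / lam :=
    fun k hk u hu => (le_div_iff₀' hlam).2 (hκ k hk u hu)
  have hlo : ulo ∈ Set.Icc ulo uhi := Set.left_mem_Icc.2 hlt.le
  have hhi : uhi ∈ Set.Icc ulo uhi := Set.right_mem_Icc.2 hlt.le
  have hflux : ∀ i, ∀ w ∈ Set.Icc ulo uhi,
      lam * |f (K i) (m i) - f (K i) w| ≤ κ * |m i - w| := by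
    intro i w hw
    have := hf.abs_sub_le hM (hK i) hw (hmem i)
    calc lam * |f (K i) (m i) - f (K i) w| ≤ lam * (κ / lam * |m i - w|) := by gcongr
      _ = _ := by field_simp
  have hs := (limitedSlope_right u j).abs_sub_le (limitedSlope_left u j)
  have hs0 := (limitedSlope_right u j).abs_le_abs
  have hs1 := (limitedSlope_left u j).abs_le_abs
  have hp0 := abs_predictor_sub_le hlam hκ hK hu j
  have hp1 := abs_predictor_sub_le hlam hκ hK hu (j + 1)
  rw [← hm] at hp0 hp1
  have hq0 : |m j - u j| ≤ |u (j + 1) - u j| := by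
    calc _ ≤ κ / 2 * |limitedSlope u j| := hp0
      _ ≤ 1 * |u (j + 1) - u j| := by gcongr; linarith
      _ = _ := one_mul _
  have hq1 : |m (j + 1) - u (j + 1)| ≤ |u (j + 1) - u j| := by
    calc _ ≤ κ / 2 * |limitedSlope u (j + 1)| := hp1
      _ ≤ 1 * |u (j + 1) - u j| := by gcongr; linarith
      _ = _ := one_mul _
  obtain ⟨u0, u0'⟩ := hu j
  obtain ⟨u1, u1'⟩ := hu (j + 1)
  rw [abs_le] at hs hq0 hq1
  have hd1 : |u (j + 1) - u j| ≤ (u j - ulo) + (u (j + 1) - ulo) :=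
    abs_le.2 ⟨by linarith, by linarith⟩
  have hd2 : |u (j + 1) - u j| ≤ (uhi - u j) + (uhi - u (j + 1)) :=
    abs_le.2 ⟨by linarith, by linarith⟩
  have hsmall : ∀ x y : ℝ, lam * |x| ≤ κ * |y| → |lam * x| ≤ 1 / 16 * |y| := by
    intro x y h
    rw [abs_mul, abs_of_pos hlam]
    refine h.trans ?_
    gcongr
    linarith
  have b0 := hsmall _ _ (hflux j ulo hlo)
  have b1 := hsmall _ _ (hflux (j + 1) ulo hlo)
  have c0 := hsmall _ _ (hflux j uhi hhi)
  have c1 := hsmall _ _ (hflux (j + 1) uhi hhi)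
  rw [abs_of_nonneg (sub_nonneg.2 (hmem _).1), abs_le] at b0 b1
  rw [abs_of_nonpos (sub_nonpos.2 (hmem _).2), abs_le] at c0 c1
  -- At the extreme states the flux does not depend on k, so both cell fluxes are compared with one
  -- common value. The flux difference is then small relative to the distance from that state, and
  -- averaging dominates.
  have e1 := hf.eq_at_bot (K j) (hK j) (K (j + 1)) (hK (j + 1))
  have e2 := hf.eq_at_top (K j) (hK j) (K (j + 1)) (hK (j + 1))
  rw [e1] at b0
  rw [e2] at c0
  rw [corrector, ← hm]
  constructor <;> linarith

/-- The entropy flux of the square entropy. -/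
noncomputable def entropyFlux (f : ℝ → ℝ → ℝ) (ulo uhi k u : ℝ) : ℝ :=
  2 * u * f k u - 2 * fluxPrimitive f ulo uhi k u

/-- The difference between the left side and the entropy flux difference is exactly the trapezoidal
error on [a, b]; it changes sign when the end points are exchanged. -/
theorem FluxHypotheses.entropy_le (hf : FluxHypotheses f klo khi ulo uhi γ₁ γ₂) (hlt : ulo < uhi)
    {k a b : ℝ} (hk : k ∈ Set.Icc klo khi) (ha : a ∈ Set.Icc ulo uhi) (hb : b ∈ Set.Icc ulo uhi) :
    -((a + b) * (f k b - f k a)) ≤ entropyFlux f ulo uhi k a - entropyFlux f ulo uhi k b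
      + (max (b - a) 0 ^ 2 * (fluxDu f ulo uhi k b - fluxDu f ulo uhi k a) / 2
        - γ₁ / 6 * max (-(b - a)) 0 ^ 3) := by
  unfold entropyFlux
  rcases le_total a b with h | h
  · have := hf.trapezoid_sub_le hlt hk ha hb h
    rw [max_eq_left (sub_nonneg.2 h), max_eq_right (by linarith)]
    linarith
  · have := hf.le_trapezoid_sub hlt hk hb ha h
    rw [max_eq_right (sub_nonpos.2 h), max_eq_left (by linarith), neg_sub]
    linarith

theorem FluxHypotheses.abs_fluxPrimitive_sub_le {L k₁ k₂ : ℝ}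
    (hf : FluxHypotheses f klo khi ulo uhi γ₁ γ₂) (hlt : ulo < uhi)
    (hL : ∀ u ∈ Set.Icc ulo uhi, |f k₂ u - f k₁ u| ≤ L)
    (hk₁ : k₁ ∈ Set.Icc klo khi) (hk₂ : k₂ ∈ Set.Icc klo khi) {w : ℝ} (hw : w ∈ Set.Icc ulo uhi) :
    |fluxPrimitive f ulo uhi k₂ w - fluxPrimitive f ulo uhi k₁ w| ≤ L * (uhi - ulo) := by
  have hL0 : 0 ≤ L := (abs_nonneg _).trans (hL w hw)
  unfold fluxPrimitive
  rw [← intervalIntegral.integral_sub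
    ((hf.continuous_clamp hlt hk₂).intervalIntegrable _ _)
    ((hf.continuous_clamp hlt hk₁).intervalIntegrable _ _)]
  have := intervalIntegral.norm_integral_le_of_norm_le_const (a := ulo) (b := w) (C := L)
    (f := fun x => f k₂ (max ulo (min uhi x)) - f k₁ (max ulo (min uhi x)))
    (fun x _ => hL _ (clamp_mem hlt.le x))
  rw [Real.norm_eq_abs, abs_of_nonneg (sub_nonneg.2 hw.1)] at this
  exact this.trans (by gcongr; exact hw.2)

theorem FluxHypotheses.abs_fluxPrimitive_le {M k : ℝ} (hlt : ulo < uhi)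
    (hM : ∀ u ∈ Set.Icc ulo uhi, |f k u| ≤ M) {w : ℝ} (hw : w ∈ Set.Icc ulo uhi) :
    |fluxPrimitive f ulo uhi k w| ≤ M * (uhi - ulo) := by
  have hM0 : 0 ≤ M := (abs_nonneg _).trans (hM w hw)
  have := intervalIntegral.norm_integral_le_of_norm_le_const (a := ulo) (b := w) (C := M)
    (f := fun x => f k (max ulo (min uhi x))) (fun x _ => hM _ (clamp_mem hlt.le x))
  rw [Real.norm_eq_abs, abs_of_nonneg (sub_nonneg.2 hw.1)] at this
  exact this.trans (by gcongr; exact hw.2)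

/-- The scheme satisfies the hypotheses of the Lyapunov inequality, with constants that do not
depend on the grid. -/
theorem exists_staggeredStep (hf : FluxHypotheses f klo khi ulo uhi γ₁ γ₂) (hlt : ulo < uhi)
    (hk : klo ≤ khi) (hlam : 0 < lam) (hκ1 : κ ≤ γ₁ / (7500 * γ₂))
    (hκ : ∀ k ∈ Set.Icc klo khi, ∀ u ∈ Set.Icc ulo uhi, lam * |fluxDu f ulo uhi k u| ≤ κ) :
    ∃ E B : ℝ, 0 ≤ E ∧ ∀ K u : ℤ → ℝ, (∀ j, K j ∈ Set.Icc klo khi) →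
      (∀ j, u j ∈ Set.Icc ulo uhi) → ∃ R ν ν' μ q ε : ℤ → ℝ,
        StaggeredStep κ (lam * γ₁) (lam * γ₂) (boundC ulo uhi) B u (corrector f ulo uhi lam K u)
          (limitedSlope u) R ν ν' μ q (fun j => E * |K (j + 1) - K j|) ε := by
  have hγ := hf.gamma_le hlt hk
  have hγ1 := hf.gamma_pos
  have hγ2 : 0 < γ₂ := hγ1.trans_le hγ
  have hloK : klo ∈ Set.Icc klo khi := Set.left_mem_Icc.2 hk
  have hlo : ulo ∈ Set.Icc ulo uhi := Set.left_mem_Icc.2 hlt.le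
  have hκ0 : 0 ≤ κ := (by positivity : 0 ≤ lam * |fluxDu f ulo uhi klo ulo|).trans
    (hκ klo hloK ulo hlo)
  have hκγ : κ * γ₂ ≤ γ₁ / 7500 := by
    calc κ * γ₂ ≤ γ₁ / (7500 * γ₂) * γ₂ := by gcongr
      _ = _ := by field_simp
  have hκ2 : κ ≤ 1 / 7500 := by
    have : κ * γ₂ ≤ 1 / 7500 * γ₂ := by linarith
    exact le_of_mul_le_mul_right this hγ2
  have hM : ∀ k ∈ Set.Icc klo khi, ∀ u ∈ Set.Icc ulo uhi, |fluxDu f ulo uhi k u| ≤ κ / lam :=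
    fun k hk u hu => (le_div_iff₀' hlam).2 (hκ k hk u hu)
  obtain ⟨L, hL0, hL⟩ := hf.exists_lipschitz_k hlt hM
  set U := boundC ulo uhi with hU
  have hUb : ∀ w ∈ Set.Icc ulo uhi, |w| ≤ U := by
    intro w hw
    rw [hU, boundC]
    have h1 := le_max_left |ulo| |uhi|
    have h2 := le_max_right |ulo| |uhi|
    exact abs_le.2 ⟨by linarith [hw.1, neg_abs_le ulo], by linarith [hw.2, le_abs_self uhi]⟩
  have hU0 : 0 ≤ U := (abs_nonneg _).trans (hUb ulo hlo)
  have hDu : 0 < uhi - ulo := sub_pos.2 hlt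
  set Mf := |f klo ulo| + κ / lam * (uhi - ulo) with hMf
  have hfb : ∀ k ∈ Set.Icc klo khi, ∀ w ∈ Set.Icc ulo uhi, |f k w| ≤ Mf := by
    intro k hk w hw
    have h1 := hf.abs_sub_le hM hk hlo hw
    have h2 := hf.eq_at_bot k hk klo hloK
    have h3 : κ / lam * |w - ulo| ≤ κ / lam * (uhi - ulo) := by
      rw [abs_of_nonneg (sub_nonneg.2 hw.1)]
      gcongr; exact hw.2
    rw [h2] at h1
    calc |f k w| = |(f k w - f klo ulo) + f klo ulo| := by rw [sub_add_cancel]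
      _ ≤ |f k w - f klo ulo| + |f klo ulo| := abs_add_le _ _
      _ ≤ Mf := by linarith
  have hMf0 : 0 ≤ Mf := by positivity
  -- In E, the 1 covers the jumps of speed and flux in k, and the other two terms the jump of the
  -- entropy flux.
  refine ⟨lam * L * (1 + 2 * U + 2 * (uhi - ulo)), lam * (2 * U * Mf + 2 * (Mf * (uhi - ulo))),
    by positivity, ?_⟩
  intro K u hK hu
  choose ξ hξ hξ' using fun j => hf.exists_fluxDu_eq_slope (hK j) (hu j) (hu (j + 1))
  have hξI : ∀ j, ξ j ∈ Set.Icc ulo uhi := fun j =>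
    Set.ordConnected_Icc.uIcc_subset (hu j) (hu (j + 1)) (hξ j)
  have hspeed : ∀ k ∈ Set.Icc klo khi, ∀ w ∈ Set.Icc ulo uhi,
      |lam * fluxDu f ulo uhi k w| ≤ κ := fun k hk w hw => by
    rw [abs_mul, abs_of_pos hlam]; exact hκ k hk w hw
  have hspeedLip : ∀ k ∈ Set.Icc klo khi, ∀ w ∈ Set.Icc ulo uhi, ∀ w' ∈ Set.Icc ulo uhi,
      |lam * fluxDu f ulo uhi k w - lam * fluxDu f ulo uhi k w'| ≤ lam * γ₂ * |w - w'| := by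
    intro k hk w hw w' hw'
    rw [← mul_sub, abs_mul, abs_of_pos hlam, mul_assoc]
    gcongr
    exact hf.abs_fluxDu_sub_le hlt hk hw' hw
  have hEle : ∀ j, lam * (L * |K (j + 1) - K j|) ≤
      lam * L * (1 + 2 * U + 2 * (uhi - ulo)) * |K (j + 1) - K j| := by
    intro j
    have : 0 ≤ lam * L * |K (j + 1) - K j| := by positivity
    nlinarith [mul_nonneg this hU0, mul_nonneg this hDu.le]
  -- On edge j the coefficient is frozen at K j: ν and ν' are the end speeds, μ the mean-value
  -- speed. R is the Taylor remainder at the predictor, and ε the flux jump due to changing the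
  -- coefficient at the right end.
  refine ⟨fun j => lam * (f (K j) (predictor f ulo uhi lam K u j) - f (K j) (u j))
      + (lam * fluxDu f ulo uhi (K j) (u j)) ^ 2 * limitedSlope u j / 2,
    fun j => lam * fluxDu f ulo uhi (K j) (u j), fun j => lam * fluxDu f ulo uhi (K j) (u (j + 1)),
    fun j => lam * fluxDu f ulo uhi (K j) (ξ j), fun j => lam * entropyFlux f ulo uhi (K j) (u j),
    fun j => lam * (f (K (j + 1)) (u (j + 1)) - f (K j) (u (j + 1))), ?_⟩
  refine
    { κ_nonneg := hκ0
      κ_le := hκ2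
      κ_mul_le := ?_
      ℓ₂_nonneg := by positivity
      ℓ₂_mul_le := ?_
      abs_u_le := fun j => hUb _ (hu j)
      abs_v_le := fun j => hUb _ (corrector_mem hf hlt hlam hκ2 hκ hK hu j)
      slope_left := limitedSlope_left u
      slope_right := limitedSlope_right u
      posPart_slope := posPart_limitedSlope u
      abs_ν_le := fun j => hspeed _ (hK j) _ (hu j)
      abs_ν'_le := fun j => hspeed _ (hK j) _ (hu (j + 1))
      abs_μ_le := fun j => hspeed _ (hK j) _ (hξI j)
      abs_R_le := ?_
      abs_μ_sub_ν_le := ?_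
      abs_ν'_sub_μ_le := ?_
      le_ν'_sub_ν := ?_
      e_nonneg := fun j => by positivity
      abs_ν_sub_ν'_le := ?_
      abs_ε_le := ?_
      abs_q_le := ?_
      entropy_le := ?_
      v_eq := ?_ }
  · calc κ * (lam * γ₂) = lam * (κ * γ₂) := by ring
      _ ≤ lam * (γ₁ / 7500) := by gcongr
      _ = _ := by ring
  -- Uniform convexity bounds the jump by the range of speeds, λγ₁|d| ≤ 2κ, and κγ₂ ≤ γ₁/7500
  -- converts γ₁ into γ₂.
  · intro j
    have h1 : γ₁ * |u (j + 1) - u j| ≤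
        |fluxDu f ulo uhi (K j) (u (j + 1)) - fluxDu f ulo uhi (K j) (u j)| := by
      rcases le_total (u j) (u (j + 1)) with h | h
      · rw [abs_of_nonneg (sub_nonneg.2 h)]
        exact (hf.fluxDu_sub_mem hlt (hK j) (hu j) (hu (j + 1)) h).1.trans (le_abs_self _)
      · rw [abs_sub_comm, abs_of_nonneg (sub_nonneg.2 h), abs_sub_comm]
        exact (hf.fluxDu_sub_mem hlt (hK j) (hu (j + 1)) (hu j) h).1.trans (le_abs_self _)
    have h2 : lam * (γ₁ * |u (j + 1) - u j|) ≤ 2 * κ := by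
      have a1 := hκ _ (hK j) _ (hu j)
      have a2 := hκ _ (hK j) _ (hu (j + 1))
      calc lam * (γ₁ * |u (j + 1) - u j|) ≤ lam * (|fluxDu f ulo uhi (K j) (u (j + 1))|
            + |fluxDu f ulo uhi (K j) (u j)|) := by
              gcongr; exact h1.trans (abs_sub _ _)
        _ ≤ _ := by linarith
    have h3 : γ₁ * (lam * γ₂ * |u (j + 1) - u j|) ≤ γ₁ * 1 := by
      calc γ₁ * (lam * γ₂ * |u (j + 1) - u j|) = γ₂ * (lam * (γ₁ * |u (j + 1) - u j|)) := by ring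
        _ ≤ γ₂ * (2 * κ) := by gcongr
        _ ≤ _ := by linarith
    exact le_of_mul_le_mul_left h3 hγ1
  · intro j
    obtain ⟨η, hη, hη'⟩ := hf.exists_fluxDu_eq_slope (hK j) (hu j)
      (predictor_mem hlam (by linarith) hκ hK hu j)
    have hηI : η ∈ Set.Icc ulo uhi := Set.ordConnected_Icc.uIcc_subset (hu j)
      (predictor_mem hlam (by linarith) hκ hK hu j) hη
    have hηd : |η - u j| ≤ κ / 2 * |limitedSlope u j| :=
      (Set.abs_sub_left_of_mem_uIcc hη).trans (abs_predictor_sub_le hlam hκ hK hu j)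
    have h1 := hspeedLip _ (hK j) _ (hu j) _ hηI
    have h2 := hspeed _ (hK j) _ (hu j)
    rw [abs_sub_comm (u j)] at h1
    rw [hη', show lam * (fluxDu f ulo uhi (K j) η * (predictor f ulo uhi lam K u j - u j))
        + (lam * fluxDu f ulo uhi (K j) (u j)) ^ 2 * limitedSlope u j / 2
        = (lam * fluxDu f ulo uhi (K j) (u j) - lam * fluxDu f ulo uhi (K j) η)
          * (lam * fluxDu f ulo uhi (K j) (u j) * limitedSlope u j) / 2 by
        rw [predictor]; ring, abs_div, abs_mul, abs_mul _ (limitedSlope u j), abs_two]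
    calc _ ≤ lam * γ₂ * (κ / 2 * |limitedSlope u j|) * (κ * |limitedSlope u j|) / 2 := by
          gcongr
          exact h1.trans (by gcongr)
      _ = lam * γ₂ * κ ^ 2 * |limitedSlope u j| ^ 2 / 4 := by ring
      _ = _ := by rw [sq_abs]
  · intro j
    refine (hspeedLip _ (hK j) _ (hξI j) _ (hu j)).trans ?_
    exact mul_le_mul_of_nonneg_left (Set.abs_sub_left_of_mem_uIcc (hξ j)) (by positivity)
  · intro j
    refine (hspeedLip _ (hK j) _ (hu (j + 1)) _ (hξI j)).trans ?_
    exact mul_le_mul_of_nonneg_left (Set.abs_sub_right_of_mem_uIcc (hξ j)) (by positivity)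
  · intro j hj
    have := (hf.fluxDu_sub_mem hlt (hK j) (hu j) (hu (j + 1)) (sub_nonneg.1 hj)).1
    rw [← mul_sub, mul_assoc]
    gcongr
  · intro j
    rw [← mul_sub, abs_mul, abs_of_pos hlam]
    refine le_trans ?_ (hEle j)
    gcongr
    exact (hL _ (hK j) _ (hK (j + 1)) _ (hu (j + 1))).2
  · intro j
    rw [abs_mul, abs_of_pos hlam]
    refine le_trans ?_ (hEle j)
    gcongr
    exact (hL _ (hK j) _ (hK (j + 1)) _ (hu (j + 1))).1
  · intro j
    rw [abs_mul, abs_of_pos hlam, entropyFlux]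
    gcongr
    refine (abs_sub _ _).trans ?_
    rw [abs_mul, abs_mul, abs_mul, abs_two]
    have h1 := hUb _ (hu j)
    have h2 := hfb _ (hK j) _ (hu j)
    have h3 := FluxHypotheses.abs_fluxPrimitive_le hlt (hfb _ (hK j)) (hu j)
    gcongr
  · intro j
    have h1 := hf.entropy_le hlt (hK j) (hu j) (hu (j + 1))
    rw [hξ' j] at h1
    have h2 := mul_le_mul_of_nonneg_left h1 hlam.le
    have h3 := fun w hw => (hL _ (hK j) _ (hK (j + 1)) w hw).1
    have h4 := hf.abs_fluxPrimitive_sub_le hlt h3 (hK j) (hK (j + 1)) (hu (j + 1))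
    have h5 : |entropyFlux f ulo uhi (K (j + 1)) (u (j + 1))
        - entropyFlux f ulo uhi (K j) (u (j + 1))| ≤
        L * (1 + 2 * U + 2 * (uhi - ulo)) * |K (j + 1) - K j| := by
      have h6 : |u (j + 1) * (f (K (j + 1)) (u (j + 1)) - f (K j) (u (j + 1)))| ≤
          U * (L * |K (j + 1) - K j|) := by
        rw [abs_mul]
        exact mul_le_mul (hUb _ (hu (j + 1))) (h3 _ (hu (j + 1))) (abs_nonneg _) hU0
      have h7 : 0 ≤ L * |K (j + 1) - K j| := by positivity
      unfold entropyFlux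
      rw [abs_le] at h4 h6 ⊢
      constructor <;> linarith
    have h8 := mul_le_mul_of_nonneg_left h5 hlam.le
    have h9 : lam * (entropyFlux f ulo uhi (K (j + 1)) (u (j + 1))
        - entropyFlux f ulo uhi (K j) (u (j + 1))) ≤ lam * |entropyFlux f ulo uhi (K (j + 1))
        (u (j + 1)) - entropyFlux f ulo uhi (K j) (u (j + 1))| := by
      gcongr; exact le_abs_self _
    linarith
  · intro j
    have h1 : lam * fluxDu f ulo uhi (K j) (ξ j) * (u (j + 1) - u j) =
        lam * (f (K j) (u (j + 1)) - f (K j) (u j)) := by rw [hξ' j]; ring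
    rw [h1]
    simp only [fluxCorrection, corrector]
    ring

end

/-! ### Cell averages and their variation. -/

section

variable {g : ℝ → ℝ} {Δx c : ℝ} {m : ℤ}

theorem cell_length (Δx : ℝ) (m : ℤ) :
    ((m : ℝ) + 1) / 2 * Δx - ((m : ℝ) - 1) / 2 * Δx = Δx := by ring

theorem cell_le (hΔx : 0 < Δx) (m : ℤ) : ((m : ℝ) - 1) / 2 * Δx ≤ ((m : ℝ) + 1) / 2 * Δx := by
  linarith [cell_length Δx m]

theorem cellAverage_le (hΔx : 0 < Δx)
    (hg : IntervalIntegrable g volume (((m : ℝ) - 1) / 2 * Δx) (((m : ℝ) + 1) / 2 * Δx))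
    (h : ∀ᵐ x, x ∈ Set.Icc (((m : ℝ) - 1) / 2 * Δx) (((m : ℝ) + 1) / 2 * Δx) → g x ≤ c) :
    cellAverage g Δx m ≤ c := by
  have h1 := intervalIntegral.integral_mono_ae_restrict (cell_le hΔx m) hg
    (intervalIntegrable_const (c := c)) ((ae_restrict_iff' measurableSet_Icc).2 h)
  rw [intervalIntegral.integral_const, cell_length, smul_eq_mul] at h1
  rw [cellAverage, one_div, inv_mul_le_iff₀ hΔx]
  exact h1

theorem le_cellAverage (hΔx : 0 < Δx)
    (hg : IntervalIntegrable g volume (((m : ℝ) - 1) / 2 * Δx) (((m : ℝ) + 1) / 2 * Δx))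
    (h : ∀ᵐ x, x ∈ Set.Icc (((m : ℝ) - 1) / 2 * Δx) (((m : ℝ) + 1) / 2 * Δx) → c ≤ g x) :
    c ≤ cellAverage g Δx m := by
  have h1 := intervalIntegral.integral_mono_ae_restrict (cell_le hΔx m)
    (intervalIntegrable_const (c := c)) hg ((ae_restrict_iff' measurableSet_Icc).2 h)
  rw [intervalIntegral.integral_const, cell_length, smul_eq_mul] at h1
  rw [cellAverage, one_div, le_inv_mul_iff₀ hΔx]
  exact h1

theorem MemLinftyBV.cellAverage_mem {lo hi : ℝ} (hg : MemLinftyBV g) (hΔx : 0 < Δx)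
    (h : ∀ᵐ x, g x ∈ Set.Icc lo hi) (m : ℤ) : cellAverage g Δx m ∈ Set.Icc lo hi := by
  have hi : ∀ a b : ℝ, IntervalIntegrable g volume a b := fun a b =>
    ((hg.1.locallyIntegrable le_top).integrableOn_isCompact isCompact_uIcc).intervalIntegrable
  exact ⟨le_cellAverage hΔx (hi _ _) (h.mono fun x hx _ => hx.1),
    cellAverage_le hΔx (hi _ _) (h.mono fun x hx _ => hx.2)⟩

theorem cellAverage_le_add_two (hΔx : 0 < Δx) (hg : Monotone g) (m : ℤ) :
    cellAverage g Δx m ≤ cellAverage g Δx (m + 2) := by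
  refine (cellAverage_le (c := g (((m : ℝ) + 1) / 2 * Δx)) hΔx hg.intervalIntegrable
    (Filter.Eventually.of_forall fun x hx => hg hx.2)).trans
    (le_cellAverage hΔx hg.intervalIntegrable (Filter.Eventually.of_forall fun x hx => hg ?_))
  refine le_trans (le_of_eq ?_) hx.1
  push_cast
  ring

/-- The variation of the cell averages of a function of bounded variation is bounded uniformly in
the mesh size. -/
theorem MemLinftyBV.exists_sum_abs_cellAverage_sub_le (hg : MemLinftyBV g) :
    ∃ V : ℝ, ∀ Δx : ℝ, 0 < Δx → ∀ (m : ℤ) (L : ℕ),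
      ∑ t ∈ Finset.range L,
        |cellAverage g Δx (m + 2 * t + 2) - cellAverage g Δx (m + 2 * t)| ≤ V := by
  obtain ⟨-, v, hgv, hv⟩ := hg
  set W := (eVariationOn v Set.univ).toReal with hW
  set p := variationOnFromTo v Set.univ 0 with hp
  have hp_mono : Monotone p := monotoneOn_univ.1
    (variationOnFromTo.monotoneOn hv.locallyBoundedVariationOn (Set.mem_univ 0))
  have hq_mono : Monotone (p - v) := monotoneOn_univ.1
    (variationOnFromTo.sub_self_monotoneOn hv.locallyBoundedVariationOn (Set.mem_univ 0))
  have hp_le : ∀ x, |p x| ≤ W := fun x => by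
    have hle : ∀ s, (eVariationOn v s).toReal ≤ W := fun s =>
      ENNReal.toReal_mono hv (eVariationOn.mono v (Set.subset_univ s))
    rw [hp, variationOnFromTo]
    split_ifs
    · rw [abs_of_nonneg ENNReal.toReal_nonneg]; exact hle _
    · rw [abs_neg, abs_of_nonneg ENNReal.toReal_nonneg]; exact hle _
  have hv_le : ∀ x, |v x| ≤ W + |v 0| := fun x => by
    have h1 : |v x - v 0| ≤ W := by
      have := hv.dist_le (Set.mem_univ x) (Set.mem_univ 0)
      rwa [Real.dist_eq] at this
    calc |v x| = |(v x - v 0) + v 0| := by rw [sub_add_cancel]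
      _ ≤ |v x - v 0| + |v 0| := abs_add_le _ _
      _ ≤ _ := by linarith
  have havg : ∀ Δx m, cellAverage g Δx m = cellAverage p Δx m - cellAverage (p - v) Δx m := by
    intro Δx m
    simp only [cellAverage]
    rw [← mul_sub, ← intervalIntegral.integral_sub hp_mono.intervalIntegrable
      hq_mono.intervalIntegrable]
    congr 1
    apply intervalIntegral.integral_congr_ae
    filter_upwards [hgv] with x hx _
    simp [hx]
  have hS_le : ∀ x, |(p + (p - v)) x| ≤ 3 * W + |v 0| := fun x => by
    have h1 := abs_le.1 (hp_le x)
    have h2 := abs_le.1 (hv_le x)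
    simp only [Pi.add_apply, Pi.sub_apply]
    exact abs_le.2 ⟨by linarith, by linarith⟩
  have hS_mono : Monotone (p + (p - v)) := hp_mono.add hq_mono
  have hS_avg : ∀ Δx m, cellAverage (p + (p - v)) Δx m =
      cellAverage p Δx m + cellAverage (p - v) Δx m := by
    intro Δx m
    simp only [cellAverage]
    rw [← mul_add, ← intervalIntegral.integral_add hp_mono.intervalIntegrable
      hq_mono.intervalIntegrable]
    rfl
  refine ⟨2 * (3 * W + |v 0|), fun Δx hΔx m L => ?_⟩
  have hbd : ∀ i : ℤ, |cellAverage (p + (p - v)) Δx i| ≤ 3 * W + |v 0| := fun i => abs_le.2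
    ⟨le_cellAverage hΔx hS_mono.intervalIntegrable
      (Filter.Eventually.of_forall fun x _ => (abs_le.1 (hS_le x)).1),
    cellAverage_le hΔx hS_mono.intervalIntegrable
      (Filter.Eventually.of_forall fun x _ => (abs_le.1 (hS_le x)).2)⟩
  obtain ⟨G, hG⟩ : ∃ G : ℕ → ℝ, ∀ t : ℕ, G t = cellAverage (p + (p - v)) Δx (m + 2 * t) :=
    ⟨_, fun _ => rfl⟩
  -- Jordan decomposition v = p - (p - v) into monotone functions: the averages of each increase, so
  -- the variation is bounded by the increments for their sum, which telescope.
  calc ∑ t ∈ Finset.range L, |cellAverage g Δx (m + 2 * t + 2) - cellAverage g Δx (m + 2 * t)|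
      ≤ ∑ t ∈ Finset.range L, (G (t + 1) - G t) := by
        refine Finset.sum_le_sum fun t _ => ?_
        have e1 : m + 2 * ((t + 1 : ℕ) : ℤ) = m + 2 * t + 2 := by push_cast; ring
        rw [hG, hG, e1, hS_avg, hS_avg, havg, havg]
        have h1 := cellAverage_le_add_two hΔx hp_mono (m + 2 * t)
        have h2 := cellAverage_le_add_two hΔx hq_mono (m + 2 * t)
        exact abs_le.2 ⟨by linarith, by linarith⟩
    _ = G L - G 0 := Finset.sum_range_sub G L
    _ ≤ _ := by
      have h1 := abs_le.1 (hbd (m + 2 * L))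
      have h2 := abs_le.1 (hbd (m + 2 * (0 : ℕ)))
      rw [hG, hG]
      linarith

end

/-! ### Reindexing the staggered grid and summing over time. -/

section

variable {f : ℝ → ℝ → ℝ} {klo khi ulo uhi γ₁ γ₂ lam κ Δx : ℝ} {k u₀ : ℝ → ℝ}

theorem slope_two_mul_add (v : ℤ → ℝ) (i n : ℤ) :
    slope v (2 * i + n) = limitedSlope (fun i => v (2 * i + n)) i := by
  have e1 : 2 * (i + 1) + n = 2 * i + n + 2 := by ring
  have e2 : 2 * (i - 1) + n = 2 * i + n - 2 := by ring
  simp only [slope, limitedSlope, e1, e2]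
  congr 1
  ring

/-- The substitution m = 2i + n removes the parity condition: new cell i lies between old cells i
and i + 1. -/
theorem step_two_mul_add (κd v : ℤ → ℝ) (i n : ℤ) :
    step f ulo uhi lam κd v (2 * i + n + 1) =
      corrector f ulo uhi lam (fun i => κd (2 * i + n)) (fun i => v (2 * i + n)) i := by
  have e1 : 2 * i + n + 1 + 1 = 2 * (i + 1) + n := by ring
  have e2 : 2 * i + n + 1 - 1 = 2 * i + n := by ring
  simp only [step, corrector, midValue, predictor, e1, e2, slope_two_mul_add]
  ring

/-- The cell values at time level `n`, numbered by consecutive integers. -/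
noncomputable def levelValues (f : ℝ → ℝ → ℝ) (ulo uhi lam : ℝ) (k u₀ : ℝ → ℝ) (Δx : ℝ) (n : ℕ)
    (i : ℤ) : ℝ :=
  approx f ulo uhi lam k u₀ Δx n (2 * i + n)

theorem levelValues_succ (n : ℕ) :
    levelValues f ulo uhi lam k u₀ Δx (n + 1) =
      corrector f ulo uhi lam (fun i => cellAverage k Δx (2 * i + n))
        (levelValues f ulo uhi lam k u₀ Δx n) := by
  funext i
  have := step_two_mul_add (f := f) (ulo := ulo) (uhi := uhi) (lam := lam) (cellAverage k Δx)
    (approx f ulo uhi lam k u₀ Δx n) i n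
  simp only [levelValues, approx, Nat.cast_add, Nat.cast_one, ← add_assoc]
  exact this

theorem levelValues_mem (hf : FluxHypotheses f klo khi ulo uhi γ₁ γ₂) (hlt : ulo < uhi)
    (hlam : 0 < lam) (hκ1 : κ ≤ 1 / 7500)
    (hκ : ∀ k ∈ Set.Icc klo khi, ∀ u ∈ Set.Icc ulo uhi, lam * |fluxDu f ulo uhi k u| ≤ κ)
    (hK : ∀ m, cellAverage k Δx m ∈ Set.Icc klo khi)
    (hu₀ : ∀ m, cellAverage u₀ Δx m ∈ Set.Icc ulo uhi) (n : ℕ) :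
    ∀ i, levelValues f ulo uhi lam k u₀ Δx n i ∈ Set.Icc ulo uhi := by
  induction n with
  | zero => exact fun i => hu₀ _
  | succ n ih =>
    rw [levelValues_succ]
    exact corrector_mem hf hlt hlam hκ1 hκ (fun i => hK _) ih

/-- The cubic sum is dominated by sums over windows of consecutive cells. -/
theorem cubicSum_le (N J : ℕ) :
    cubicSum (approx f ulo uhi lam k u₀ Δx) N J ≤
      ∑ n ∈ Finset.range N, ∑ t ∈ Finset.range (2 * (J + N) + 1),
        |levelValues f ulo uhi lam k u₀ Δx n (-((J : ℤ) + N) + t + 1)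
          - levelValues f ulo uhi lam k u₀ Δx n (-((J : ℤ) + N) + t)| ^ 3 := by
  refine Finset.sum_le_sum fun n hn => ?_
  have hn' : n < N := Finset.mem_range.1 hn
  have hinj : Set.InjOn (fun t : ℕ => 2 * (-((J : ℤ) + N) + t) + n)
      (Finset.range (2 * (J + N) + 1)) := by
    intro a _ b _ h
    simp only at h
    omega
  have e1 : ∀ t : ℕ, |levelValues f ulo uhi lam k u₀ Δx n (-((J : ℤ) + N) + t + 1)
          - levelValues f ulo uhi lam k u₀ Δx n (-((J : ℤ) + N) + t)| ^ 3 =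
      (fun m : ℤ => |approx f ulo uhi lam k u₀ Δx n (m + 2)
        - approx f ulo uhi lam k u₀ Δx n m| ^ 3) (2 * (-((J : ℤ) + N) + t) + n) := by
    intro t
    simp only [levelValues]
    congr 4
    ring
  rw [Finset.sum_congr rfl fun t _ => e1 t, ← Finset.sum_image
    (f := fun m : ℤ => |approx f ulo uhi lam k u₀ Δx n (m + 2)
        - approx f ulo uhi lam k u₀ Δx n m| ^ 3) hinj]
  refine Finset.sum_le_sum_of_subset_of_nonneg ?_ fun m _ _ => by positivity
  intro m hm
  simp only [Finset.mem_filter, Finset.mem_Icc] at hm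
  obtain ⟨⟨h1, h2⟩, r, hr⟩ := hm
  refine Finset.mem_image.2 ⟨(r - n + (J + N)).toNat, Finset.mem_range.2 ?_, ?_⟩
  · omega
  · rw [Int.toNat_of_nonneg (by omega)]
    omega

end

end CentralScheme

theorem mainTheorem5
    (f : ℝ → ℝ → ℝ) (k u₀ : ℝ → ℝ) (klo khi ulo uhi γ₁ γ₂ lam κ : ℝ)
    (hu : ulo < uhi)
    (hf : CentralScheme.FluxHypotheses f klo khi ulo uhi γ₁ γ₂)
    (hk : CentralScheme.MemLinftyBV k)
    (hk_range : ∀ᵐ x ∂(MeasureTheory.volume : MeasureTheory.Measure ℝ), k x ∈ Set.Icc klo khi)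
    (hu₀ : CentralScheme.MemLinftyBV u₀)
    (hu₀_range : ∀ᵐ x ∂(MeasureTheory.volume : MeasureTheory.Measure ℝ), u₀ x ∈ Set.Icc ulo uhi)
    (hlam : 0 < lam)
    (hcfl : CentralScheme.CFL f klo khi ulo uhi γ₁ γ₂ lam κ)
    (T X Δx₀ : ℝ) (hT : 0 < T) (hX : 0 < X) (hΔx₀ : 0 < Δx₀) :
    ∃ C : ℝ, ∀ Δx : ℝ, 0 < Δx → Δx ≤ Δx₀ →
      Δx * CentralScheme.cubicSum (CentralScheme.approx f ulo uhi lam k u₀ Δx)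
        (⌊T / (lam * Δx)⌋₊ + 1) (⌊X / Δx⌋₊ + 1) ≤ C := by
  open CentralScheme in
  have hkk : klo ≤ khi := by
    obtain ⟨x, hx⟩ := hk_range.exists
    exact hx.1.trans hx.2
  obtain ⟨hκ, hκle⟩ := hcfl
  have hκ1 : κ ≤ γ₁ / (7500 * γ₂) := hκle.trans ((min_le_left _ _).trans (min_le_left _ _))
  have hγ := hf.gamma_le hu hkk
  have hγ1 := hf.gamma_pos
  have hκ2 : κ ≤ 1 / 7500 := by
    refine hκ1.trans ?_
    rw [div_le_div_iff₀ (by linarith) (by norm_num)]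
    linarith
  obtain ⟨E, B, hE, hstep⟩ := exists_staggeredStep hf hu hkk hlam hκ1 hκ
  obtain ⟨V, hV⟩ := hk.exists_sum_abs_cellAverage_sub_le
  set U := boundC ulo uhi with hU
  set A := (48 * U ^ 2 + 2 * B) + (1 + 6 * U + 36 * U ^ 2) * (E * V + E * V) with hA
  -- The prefactor inverts the cubic decay rate λγ₁/8. The density is at most U² + (2U)² = 5U² per
  -- cell, A is the cost of one step, and the multiples of Δx₀ absorb the units added in N, J and L.
  refine ⟨8 / (lam * γ₁) * (5 * U ^ 2 * (2 * X + 2 * (T / lam) + 5 * Δx₀)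
    + |A| * (T / lam + Δx₀)), fun Δx hΔx hΔx' => ?_⟩
  set N := ⌊T / (lam * Δx)⌋₊ + 1 with hN
  set J := ⌊X / Δx⌋₊ + 1 with hJ
  set w := levelValues f ulo uhi lam k u₀ Δx with hw
  set a : ℤ := -((J : ℤ) + N) with ha
  set L := 2 * (J + N) + 1 with hL
  have hK := hk.cellAverage_mem hΔx hk_range
  have hwm := levelValues_mem hf hu hlam hκ2 hκ hK (hu₀.cellAverage_mem hΔx hu₀_range)
  have hU0 : 0 ≤ U := (abs_nonneg ulo).trans (le_max_left _ _)
  have hone : ∀ n, ∑ t ∈ Finset.range L, lyapunov (w (n + 1) (a + t))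
        (w (n + 1) (a + t + 1) - w (n + 1) (a + t))
      + lam * γ₁ / 8 * ∑ t ∈ Finset.range L, |w n (a + t + 1) - w n (a + t)| ^ 3 ≤
      ∑ t ∈ Finset.range L, lyapunov (w n (a + t)) (w n (a + t + 1) - w n (a + t)) + A := by
    intro n
    obtain ⟨R, ν, ν', μ, q, ε, h⟩ := hstep (fun i => cellAverage k Δx (2 * i + n)) (w n)
      (fun i => hK _) (hwm n)
    have h1 := h.sum_lyapunov_le a L
    rw [← levelValues_succ] at h1
    have h2 : ∀ b : ℤ, ∑ t ∈ Finset.range L, E * |cellAverage k Δx (2 * (b + t + 1) + n)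
        - cellAverage k Δx (2 * (b + t) + n)| ≤ E * V := by
      intro b
      rw [← Finset.mul_sum]
      refine mul_le_mul_of_nonneg_left (le_trans (le_of_eq ?_) (hV Δx hΔx (2 * b + n) L)) hE
      refine Finset.sum_congr rfl fun t _ => ?_
      congr 3
      · ring
      · ring
    have h3 := h2 a
    have h4 := h2 (a - 1)
    have h5 : ∀ t : ℕ, a - 1 + (t : ℤ) = a + t - 1 := fun t => by ring
    simp only [h5] at h4
    have h6 : 0 ≤ 1 + 6 * U + 36 * U ^ 2 := by positivity
    have h7 := mul_le_mul_of_nonneg_left (add_le_add h3 h4) h6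
    rw [hA]
    linarith
  have hsum : ∀ M : ℕ, lam * γ₁ / 8 * ∑ n ∈ Finset.range M, ∑ t ∈ Finset.range L,
        |w n (a + t + 1) - w n (a + t)| ^ 3
      + ∑ t ∈ Finset.range L, lyapunov (w M (a + t)) (w M (a + t + 1) - w M (a + t)) ≤
      ∑ t ∈ Finset.range L, lyapunov (w 0 (a + t)) (w 0 (a + t + 1) - w 0 (a + t)) + M * A := by
    intro M
    induction M with
    | zero => simp
    | succ M ih =>
      have := hone M
      rw [Finset.sum_range_succ]
      push_cast
      linarith
  have hinit : ∑ t ∈ Finset.range L, lyapunov (w 0 (a + t)) (w 0 (a + t + 1) - w 0 (a + t)) ≤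
      L * (5 * U ^ 2) := by
    have hb : ∀ i, |w 0 i| ≤ U := fun i => by
      have h1 := hwm 0 i
      have h2 : |ulo| ≤ U := le_max_left _ _
      have h3 : |uhi| ≤ U := le_max_right _ _
      rw [abs_le] at h2 h3 ⊢
      exact ⟨by linarith [h1.1], by linarith [h1.2]⟩
    refine (Finset.sum_le_card_nsmul _ _ (5 * U ^ 2) fun t _ => ?_).trans_eq (by simp)
    have h1 := hb (a + t)
    have h2 := hb (a + t + 1)
    have h3 : w 0 (a + t) ^ 2 ≤ U ^ 2 := by rw [← sq_abs]; gcongr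
    rw [abs_le] at h1 h2
    have h4 : max (w 0 (a + t + 1) - w 0 (a + t)) 0 ^ 2 ≤ (2 * U) ^ 2 := by
      gcongr
      exact max_le (by linarith) (by linarith)
    rw [lyapunov]
    linarith
  have hfin : 0 ≤ ∑ t ∈ Finset.range L, lyapunov (w N (a + t)) (w N (a + t + 1) - w N (a + t)) :=
    Finset.sum_nonneg fun t _ => by rw [lyapunov]; positivity
  have hcub := cubicSum_le (f := f) (ulo := ulo) (uhi := uhi) (lam := lam) (k := k) (u₀ := u₀)
    (Δx := Δx) N J
  have htot := hsum N
  have hc : 0 < lam * γ₁ / 8 := by positivity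
  have hNA : (N : ℝ) * A ≤ N * |A| := by gcongr; exact le_abs_self A
  have hmain : lam * γ₁ / 8 * cubicSum (approx f ulo uhi lam k u₀ Δx) N J ≤
      L * (5 * U ^ 2) + N * |A| := by
    have := mul_le_mul_of_nonneg_left hcub hc.le
    linarith
  have hNΔ : Δx * N ≤ T / lam + Δx₀ := by
    have h1 : (⌊T / (lam * Δx)⌋₊ : ℝ) ≤ T / (lam * Δx) := Nat.floor_le (by positivity)
    have h2 : Δx * (⌊T / (lam * Δx)⌋₊ : ℝ) ≤ Δx * (T / (lam * Δx)) := by gcongr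
    have h3 : Δx * (T / (lam * Δx)) = T / lam := by field_simp
    rw [hN]
    push_cast
    linarith
  have hJΔ : Δx * J ≤ X + Δx₀ := by
    have h1 : (⌊X / Δx⌋₊ : ℝ) ≤ X / Δx := Nat.floor_le (by positivity)
    have h2 : Δx * (⌊X / Δx⌋₊ : ℝ) ≤ Δx * (X / Δx) := by gcongr
    have h3 : Δx * (X / Δx) = X := by field_simp
    rw [hJ]
    push_cast
    linarith
  have hLΔ : Δx * L ≤ 2 * X + 2 * (T / lam) + 5 * Δx₀ := by
    rw [hL]
    push_cast
    linarith
  have hprod : lam * γ₁ / 8 * (Δx * cubicSum (approx f ulo uhi lam k u₀ Δx) N J) ≤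
      5 * U ^ 2 * (2 * X + 2 * (T / lam) + 5 * Δx₀) + |A| * (T / lam + Δx₀) := by
    calc lam * γ₁ / 8 * (Δx * cubicSum (approx f ulo uhi lam k u₀ Δx) N J)
        = Δx * (lam * γ₁ / 8 * cubicSum (approx f ulo uhi lam k u₀ Δx) N J) := by ring
      _ ≤ Δx * (L * (5 * U ^ 2) + N * |A|) := by gcongr
      _ = 5 * U ^ 2 * (Δx * L) + |A| * (Δx * N) := by ring
      _ ≤ _ := by gcongr
  rw [div_mul_eq_mul_div, le_div_iff₀ (by positivity)]
  linarith
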